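/- Let $a>0$ be real and let $k\ge 1$ be an integer. The random multigraph $H_{a,1}^{(n)}$ on the nodes $1,\dots,n$, with $n$ edges, is defined recursively: $H_{a,1}^{(1)}$ is one node with one loop, and $H_{a,1}^{(n)}$ arises from $H_{a,1}^{(n-1)}$ by adding the node $n$ and one edge from $n$ to a random node $\gamma\in\{1,\dots,n\}$ with $$\Pr(\gamma=s)=\frac{\deg_{n-1}(s)-1+a}{(a+1)n-1}\ \ (1\le s\le n-1),\qquad \Pr(\gamma=n)=\frac{a}{(a+1)n-1},$$ where $\deg_{n-1}$ is the degree in $H_{a,1}^{(n-1)}$ and loops count twice in degrees. The Buckley–Osthus random multigraph $H_{a,k}^{(t)}$ (with $t$ nodes and $kt$ edges) is obtained from $H_{a,1}^{(kt)}$ by identifying the nodes $1,\dots,k$, the nodes $k+1,\dots,2k$, and so on, and keeping all edges (so multiple edges and multiple loops may occur). Let $X(d_1,d_2,t)$ be the number of non-loop edges of $H_{a,k}^{(t)}$ linking a node of degree $d_1$ and a node of degree $d_2$, where for $d_1=d_2$ every such edge is counted twice. **Theorem 3.** There is a function $c_X(d_1,d_2)$, depending on $a$ and $k$, such that the following hold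 for all integers $d_1,d_2\ge k$; the constants implied by $O_{a,k}$ depend only on $a$ and $k$. 1. For all integers $t\ge1$, $$\mathbb E X(d_1,d_2,t)=c_X(d_1,d_2)\,t+O_{a,k}(1).$$ 2. There are real numbers $\theta(d_1,d_2)$ with $$-4+\frac{2}{1+ka}\le\theta(d_1,d_2)\le a\,\frac{\Gamma(ka+1)\,\Gamma(2ka+a+3)}{\Gamma(2ka+2)\,\Gamma(ka+a+2)}$$ such that $$c_X(d_1,d_2)=\frac{\Gamma(d_1-k+ka)\,\Gamma(d_2-k+ka)\,\Gamma(d_1+d_2-2k+2ka+3)}{\Gamma(d_1-k+ka+2)\,\Gamma(d_2-k+ka+2)\,\Gamma(d_1+d_2-2k+2ka+a+2)}\cdot ka(a+1)\frac{\Gamma(ka+a+1)}{\Gamma(ka)}$$ $$\times\left(1+\theta(d_1,d_2)\,\frac{(d_1-k+ka+1)(d_2-k+ka+1)}{(d_1+d_2-2k+2ka+1)(d_1+d_2-2k+2ka+2)}\right).$$ 3. Moreover, $$c_X(d_1,d_2)=ka(a+1)\frac{\Gamma(ka+a+1)}{\Gamma(ka)}\cdot\frac{(d_1+d_2)^{1-a}}{d_1^2d_2^2}\left(1+O_{a,k}\!\left(\frac1{d_1}+\frac1{d_2}+\frac{d_1d_2}{(d_1+d_2)^2}\right)\right).$$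 -/

import Mathlib

open scoped BigOperators

/-- A finite multigraph on `V` (loops and multiple edges allowed) is a family
`E : ι → Sym2 V` of edges.  The degree of `v` counts the edges at `v`, loops twice. -/
def multiDegree {ι V : Type*} [Fintype ι] [DecidableEq V] (E : ι → Sym2 V) (v : V) : ℕ :=
  (Finset.univ.filter fun e => v ∈ E e).card + (Finset.univ.filter fun e => E e = s(v, v)).card

/-- The number of edges joining `u` and `v`. -/
def edgeMultiplicity {ι V : Type*} [Fintype ι] [DecidableEq V] (E : ι → Sym2 V) (u v : V) : ℕ :=
  (Finset.univ.filter fun e => E e = s(u, v)).card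

/-- The total number of non-loop edges joining a node of degree `d₁` to a node of degree `d₂`;
the sum is over ordered pairs of distinct nodes, so for `d₁ = d₂` every edge is counted twice. -/
def edgesBetweenDegrees {ι V : Type*} [Fintype ι] [Fintype V] [DecidableEq V]
    (d₁ d₂ : ℕ) (E : ι → Sym2 V) : ℕ :=
  ∑ u : V, ∑ v ∈ Finset.univ.erase u,
    if multiDegree E u = d₁ ∧ multiDegree E v = d₂ then edgeMultiplicity E u v else 0

/-- The graphs on the nodes `0, …, n - 1` in which every node `i` has exactly one edge to some
node `γ i ≤ i`. -/
abbrev TargetMap (n : ℕ) : Type := (i : Fin n) → Fin (i.val + 1)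

/-- The node `γ i`, as an element of the set of all nodes. -/
def TargetMap.head {n : ℕ} (γ : TargetMap n) (i : Fin n) : Fin n := Fin.castLE i.isLt (γ i)

/-- The edges of the graph. -/
def TargetMap.edges {n : ℕ} (γ : TargetMap n) (i : Fin n) : Sym2 (Fin n) := s(i, γ.head i)

theorem sum_multiDegree {ι V : Type*} [Fintype ι] [Fintype V] [DecidableEq V]
    (E : ι → Sym2 V) : ∑ v, multiDegree E v = 2 * Fintype.card ι := by
  have key : ∀ z : Sym2 V,
      (∑ v : V, ((if v ∈ z then 1 else 0) + (if z = s(v, v) then 1 else 0)) : ℕ) = 2 := by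
    intro z
    induction z using Sym2.ind with
    | _ x y =>
      have h : ∀ v : V, ((if v ∈ s(x, y) then 1 else 0) + (if s(x, y) = s(v, v) then 1 else 0) : ℕ)
          = (if v = x then 1 else 0) + (if v = y then 1 else 0) := by
        intro v
        simp only [Sym2.mem_iff, Sym2.eq_iff]
        by_cases h1 : v = x <;> by_cases h2 : v = y <;> simp_all [eq_comm]
      rw [Finset.sum_congr rfl fun v _ => h v, Finset.sum_add_distrib]
      simp
  simp only [multiDegree, Finset.card_filter, ← Finset.sum_add_distrib]
  rw [Finset.sum_comm]
  simp [key, mul_comm]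

theorem TargetMap.one_le_degree {n : ℕ} (γ : TargetMap n) (i : Fin n) :
    1 ≤ multiDegree γ.edges i := by
  have : 0 < (Finset.univ.filter fun e => i ∈ γ.edges e).card :=
    Finset.card_pos.mpr ⟨i, by simp [TargetMap.edges]⟩
  unfold multiDegree
  omega

/-- Given the graph `γ` on `n` nodes, the probability that the edge of the new node `n` goes to
the node `s`.  With `t = n + 1` nodes after the step, it is `(deg s - 1 + a) / ((a + 1) t - 1)` for
an old node, and `a / ((a + 1) t - 1)` for the new node itself. -/
noncomputable def stepProb (a : ℝ) {n : ℕ} (γ : TargetMap n) (s : Fin (n + 1)) : ℝ :=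
  Fin.lastCases (motive := fun _ => ℝ)
    (a / ((a + 1) * ((n : ℝ) + 1) - 1))
    (fun s' => ((multiDegree γ.edges s' : ℝ) - 1 + a) / ((a + 1) * ((n : ℝ) + 1) - 1)) s

theorem stepDenom_pos {a : ℝ} (ha : 0 < a) (n : ℕ) : 0 < (a + 1) * ((n : ℝ) + 1) - 1 := by
  have : (0 : ℝ) ≤ n := n.cast_nonneg
  nlinarith [mul_nonneg ha.le this]

theorem stepProb_nonneg {a : ℝ} (ha : 0 < a) {n : ℕ} (γ : TargetMap n) (s : Fin (n + 1)) :
    0 ≤ stepProb a γ s := by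
  have hd := stepDenom_pos ha n
  induction s using Fin.lastCases with
  | last => simp only [stepProb, Fin.lastCases_last]; positivity
  | cast i =>
    simp only [stepProb, Fin.lastCases_castSucc]
    have : (1 : ℝ) ≤ multiDegree γ.edges i := by exact_mod_cast γ.one_le_degree i
    exact div_nonneg (by linarith) hd.le

theorem sum_stepProb {a : ℝ} (ha : 0 < a) {n : ℕ} (γ : TargetMap n) :
    ∑ s, stepProb a γ s = 1 := by
  have hd := stepDenom_pos ha n
  have hs : (∑ v, (multiDegree γ.edges v : ℝ)) = 2 * n := by
    have := sum_multiDegree γ.edges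
    rw [Fintype.card_fin] at this
    exact_mod_cast this
  rw [Fin.sum_univ_castSucc]
  simp only [stepProb, Fin.lastCases_last, Fin.lastCases_castSucc]
  rw [← Finset.sum_div, ← add_div, div_eq_one_iff_eq hd.ne']
  simp only [Finset.sum_add_distrib, Finset.sum_sub_distrib, hs, Finset.sum_const,
    Finset.card_univ, Fintype.card_fin, nsmul_eq_mul]
  ring

/-- The random target of the edge of the new node. -/
noncomputable def stepPMF (a : ℝ) (ha : 0 < a) {n : ℕ} (γ : TargetMap n) : PMF (Fin (n + 1)) :=
  PMF.ofFintype (fun s => ENNReal.ofReal (stepProb a γ s)) (by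
    rw [← ENNReal.ofReal_sum_of_nonneg fun s _ => stepProb_nonneg ha γ s, sum_stepProb ha γ,
      ENNReal.ofReal_one])

/-- The random graph `H_{a,1}^{(n)}`.  The recursion starts at the empty graph; as the step from it
is deterministic, `H_{a,1}^{(1)}` is one node with one loop. -/
noncomputable def onePerNode (a : ℝ) (ha : 0 < a) : (n : ℕ) → PMF (TargetMap n)
  | 0 => PMF.pure fun i => i.elim0
  | n + 1 => (onePerNode a ha n).bind fun γ =>
      (stepPMF a ha γ).map fun s => Fin.snoc (α := fun i : Fin (n + 1) => Fin (i.val + 1)) γ s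

/-- The Buckley–Osthus random graph `H_{a,k}^{(t)}`: in `H_{a,1}^{(tk)}` the consecutive groups of
`k` nodes are identified (`Fin.divNat i` is `i / k`), and all the edges are kept. -/
noncomputable def buckleyOsthus (a : ℝ) (ha : 0 < a) (k t : ℕ) :
    PMF (Fin (t * k) → Sym2 (Fin t)) :=
  (onePerNode a ha (t * k)).map fun γ e => (γ.edges e).map Fin.divNat

/-- The expectation of a real random variable on a finite probability space. -/
noncomputable def expectation {Ω : Type*} [Fintype Ω] (P : PMF Ω) (X : Ω → ℝ) : ℝ :=
  ∑ ω, (P ω).toReal * X ω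

/-- `E X(d₁, d₂, t)`. -/
noncomputable def expectedEdges (a : ℝ) (ha : 0 < a) (k d₁ d₂ t : ℕ) : ℝ :=
  expectation (buckleyOsthus a ha k t) fun E => (edgesBetweenDegrees d₁ d₂ E : ℝ)

/-!
The expected number of edges is governed by a linear recursion in the number `n` of nodes of the
graph with one edge per node, and everything follows from two maximum principles: one for that
recursion, and one for Pascal's rule.

**Recursion.** Call `x = d - k` the excess of a block (a node of the identified graph) of degree
`d`, and put `A = k * a`. With `n` nodes present, the next edge hits a complete block of excess
`x` with probability exactly `(x + A) / den a n`. The block under construction is treated as if it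
had degree `k` until it is complete. This is wrong in expectation by `O(1 / n)` per step, since
the block is hit with probability `O(1 / n)`; it reveals its loops when it is completed
(`expectation_indegree_last_le`). So the expected numbers of blocks of excess `x` and of edges
from younger blocks of excess `x` to older blocks of excess `y` satisfy closed recursions with
step errors `O(1 / n)` (`abs_sum_stepProb_nodeCount_le`, `abs_sum_stepProb_edgeCount_le`). The
exact solutions of the unperturbed recursions are `den a n` times the densities `nodeDensity` and
`edgeDensity`. Degrees flow out at a greater total rate than they flow in, so errors of order
`1 / n` per step stay bounded by a constant that does not depend on the excesses. The source of new
edges is the flow of blocks `(x + A) * nodeDensity`, so for blocks the error is needed with the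
weight `x + A` (`node_count_close`, `edge_count_close`). The principle needs nonnegative
coefficients; where the total weight `x + y + 2 * A` exceeds `den a n`, such edges can exist only
for boundedly many `n`, and the bound is direct.

**Explicit form.** Divided by `pascalFactor`, the symmetrised density satisfies Pascal's rule,
with sources on the two axes. The generalised binomial coefficients `pascalMain` and `pascalCorr`
satisfy it too, so the two bounds for the coefficient of the correction term only have to be
checked at the origin and for the increments along an axis (`pascal_nonneg`). There they amount to
`1 - a * A / (p - 1) ≤ Γ(p + a) Γ(p + A) / (Γ(p) Γ(p + A + a)) ≤ 1`, which follows from the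
recursion of this quotient in `p` and its limit `1` (`gammaQuot_le_one`, `one_sub_le_gammaQuot`).

**Asymptotics.** The bounds `(z - 1) ^ a ≤ Γ(z + a) / Γ(z) ≤ (z + a) ^ a`, a consequence of the
convexity of `log Γ`, turn the explicit form into the power law.
-/

/-! ### Densities and the maximum principles -/

/-- The weighted shift `x ↦ (x - 1 + A) f (x - 1)`, with value `0` at `x = 0`: the rate at which
blocks of excess `x - 1` become blocks of excess `x`. -/
def inflow (A : ℝ) (f : ℕ → ℝ) : ℕ → ℝ
  | 0 => 0
  | x + 1 => (x + A) * f x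

/-- The normalising constant of the attachment probabilities, with `n` nodes present. -/
def den (a : ℝ) (n : ℕ) : ℝ := (a + 1) * n + a

theorem den_pos {a : ℝ} (ha : 0 < a) (n : ℕ) : 0 < den a n := by
  unfold den; positivity

theorem den_succ (a : ℝ) (n : ℕ) : den a (n + 1) = den a n + (a + 1) := by
  unfold den; push_cast; ring

/-- The limiting proportion of blocks of excess `x`. -/
noncomputable def nodeDensity (a A : ℝ) : ℕ → ℝ
  | 0 => (a + 1) / (A + a + 1)
  | x + 1 => (x + A) * nodeDensity a A x / (x + 1 + A + a + 1)

/-- The limiting number, per block, of edges from a younger block of excess `x` to an older block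
of excess `y`. -/
noncomputable def edgeDensity (a A : ℝ) : ℕ → ℕ → ℝ
  | 0, 0 => 0
  | 0, y + 1 => ((y + A) * edgeDensity a A 0 y + (y + A) * nodeDensity a A y) /
      (y + 1 + 2 * A + a + 1)
  | x + 1, 0 => (x + A) * edgeDensity a A x 0 / (x + 1 + 2 * A + a + 1)
  | x + 1, y + 1 => ((x + A) * edgeDensity a A x (y + 1) + (y + A) * edgeDensity a A (x + 1) y) /
      (x + 1 + (y + 1) + 2 * A + a + 1)

section
variable {a A : ℝ}

theorem inflow_sub (f g : ℕ → ℝ) (x : ℕ) :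
    inflow A (fun i => f i - g i) x = inflow A f x - inflow A g x := by
  cases x <;> simp [inflow]; ring

theorem inflow_mul_right (f : ℕ → ℝ) (c : ℝ) (x : ℕ) :
    inflow A (fun i => f i * c) x = inflow A f x * c := by
  cases x <;> simp [inflow]; ring

theorem inflow_sum {ι : Type*} (s : Finset ι) (f : ι → ℕ → ℝ) (x : ℕ) :
    inflow A (fun j => ∑ i ∈ s, f i j) x = ∑ i ∈ s, inflow A (f i) x := by
  cases x <;> simp [inflow, Finset.mul_sum]

theorem abs_inflow_le (hA : 0 < A) {f : ℕ → ℝ} {K : ℝ} (hf : ∀ i, |f i| ≤ K) (x : ℕ) :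
    |inflow A f x| ≤ (x + A - min 1 A) * K := by
  have hK : 0 ≤ K := (abs_nonneg _).trans (hf 0)
  cases x with
  | zero => simp only [inflow, abs_zero, CharP.cast_eq_zero, zero_add]
            exact mul_nonneg (by simp) hK
  | succ x =>
    have hx : (0 : ℝ) ≤ x := x.cast_nonneg
    simp only [inflow, abs_mul, Nat.cast_add, Nat.cast_one]
    rw [abs_of_pos (by positivity)]
    exact mul_le_mul (by linarith [min_le_left 1 A]) (hf x) (abs_nonneg _)
      (by linarith [min_le_left 1 A])

theorem nodeDensity_rec (ha : 0 < a) (hA : 0 < A) (x : ℕ) :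
    (x + A + a + 1) * nodeDensity a A x =
      inflow A (nodeDensity a A) x + if x = 0 then a + 1 else 0 := by
  cases x with
  | zero => simp [nodeDensity, inflow]; field_simp
  | succ x => simp [nodeDensity, inflow]; field_simp

theorem edgeDensity_rec (ha : 0 < a) (hA : 0 < A) (x y : ℕ) :
    (x + y + 2 * A + a + 1) * edgeDensity a A x y =
      inflow A (fun i => edgeDensity a A i y) x + inflow A (edgeDensity a A x) y +
        if x = 0 then inflow A (nodeDensity a A) y else 0 := by
  cases x <;> cases y <;> simp [edgeDensity, inflow] <;> field_simp

theorem nodeDensity_nonneg (ha : 0 < a) (hA : 0 < A) (x : ℕ) : 0 ≤ nodeDensity a A x := by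
  induction x with
  | zero => unfold nodeDensity; positivity
  | succ x ih => unfold nodeDensity; positivity

theorem edgeDensity_nonneg (ha : 0 < a) (hA : 0 < A) (x y : ℕ) : 0 ≤ edgeDensity a A x y := by
  induction x generalizing y with
  | zero =>
    induction y with
    | zero => simp [edgeDensity]
    | succ y ih => have := nodeDensity_nonneg ha hA y; unfold edgeDensity; positivity
  | succ x ihx =>
    induction y with
    | zero => have := ihx 0; unfold edgeDensity; positivity
    | succ y ih => have := ihx (y + 1); unfold edgeDensity; positivity

theorem mul_nodeDensity_le (ha : 0 < a) (hA : 0 < A) (x : ℕ) :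
    (x + A) * (x + A + 1) * nodeDensity a A x ≤ A * (A + 1) := by
  induction x with
  | zero =>
    simp only [nodeDensity, CharP.cast_eq_zero, zero_add]
    apply mul_le_of_le_one_right (by positivity)
    rw [div_le_one (by positivity)]; linarith
  | succ x ih =>
    refine le_trans ?_ ih
    have h := nodeDensity_nonneg ha hA x
    simp only [nodeDensity, Nat.cast_add, Nat.cast_one]
    rw [mul_div_assoc', div_le_iff₀ (by positivity)]
    have : 0 ≤ (x + A) * (x + A + 1) * nodeDensity a A x * a := by positivity
    nlinarith

theorem mul_nodeDensity_le' (ha : 0 < a) (hA : 0 < A) (x : ℕ) :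
    (x + A) * nodeDensity a A x ≤ A * (A + 1) := by
  refine le_trans ?_ (mul_nodeDensity_le ha hA x)
  have h := nodeDensity_nonneg ha hA x
  have : 0 ≤ (x + A) * (x + A) * nodeDensity a A x := by positivity
  nlinarith

theorem mul_edgeDensity_le (ha : 0 < a) (hA : 0 < A) (x y : ℕ) :
    (x + y + 2 * A + 1) * edgeDensity a A x y ≤ 2 * (A * (A + 1)) := by
  set K := 2 * (A * (A + 1)) with hK
  have hKpos : 0 < K := by positivity
  -- it suffices to bound the numerators of the recursion by `K`
  have step : ∀ {w c u : ℝ}, 0 ≤ w → 0 < u → u * c ≤ K → w * c ≤ w * K / u := by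
    intro w c u hw hu h
    rw [mul_div_assoc]
    exact mul_le_mul_of_nonneg_left (by rwa [le_div_iff₀ hu, mul_comm]) hw
  have fin : ∀ {s p : ℝ}, 0 < s → p ≤ K → (s + 1) * (p / (s + a + 1)) ≤ K := by
    intro s p hs hp
    rw [mul_div_assoc', div_le_iff₀ (by positivity)]
    nlinarith [mul_pos hKpos ha]
  induction x generalizing y with
  | zero =>
    induction y with
    | zero => simp only [edgeDensity, mul_zero]; positivity
    | succ y ih =>
      have hu : (0 : ℝ) < y + 2 * A + 1 := by positivity
      have h1 := step (w := y + A) (by positivity) hu (by simpa using ih)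
      have h2 := mul_nodeDensity_le ha hA y
      have h3 : (y + A) * nodeDensity a A y ≤ K / (y + 2 * A + 1) := by
        rw [le_div_iff₀ hu]
        have : 0 ≤ (y + A) * nodeDensity a A y :=
          mul_nonneg (by positivity) (nodeDensity_nonneg ha hA y)
        nlinarith
      have h4 : (y + A) * edgeDensity a A 0 y + (y + A) * nodeDensity a A y ≤ K := by
        refine (add_le_add h1 h3).trans ?_
        rw [← add_div, div_le_iff₀ hu]
        nlinarith [mul_pos hKpos hA]
      have := fin (s := y + 1 + 2 * A) (by positivity) h4
      simpa [edgeDensity] using this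
  | succ x ihx =>
    induction y with
    | zero =>
      have hu : (0 : ℝ) < x + 2 * A + 1 := by positivity
      have h1 := step (w := x + A) (by positivity) hu (by simpa using ihx 0)
      have h4 : (x + A) * edgeDensity a A x 0 ≤ K := by
        refine h1.trans ?_
        rw [div_le_iff₀ hu]
        nlinarith [mul_pos hKpos hA]
      have := fin (s := x + 1 + 2 * A) (by positivity) h4
      simpa [edgeDensity] using this
    | succ y ih =>
      have hu : (0 : ℝ) < x + y + 1 + 2 * A + 1 := by positivity
      have h1 := step (w := x + A) (by positivity) hu
        (by have := ihx (y + 1); push_cast at this; convert this using 2; ring)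
      have h2 := step (w := y + A) (by positivity) hu
        (by push_cast at ih; convert ih using 2; ring)
      have h4 : (x + A) * edgeDensity a A x (y + 1) + (y + A) * edgeDensity a A (x + 1) y ≤ K := by
        refine (add_le_add h1 h2).trans ?_
        rw [← add_div, div_le_iff₀ hu]
        nlinarith [mul_pos hKpos hA]
      have := fin (s := x + 1 + (y + 1) + 2 * A) (by positivity) h4
      simpa [edgeDensity] using this

/-- The maximum principle for the number `N n x` of blocks of excess `x`.  The error, weighted by
`x + A`, stays bounded: the weights `min (x + 1) (k + 2) / (x + A)` are super-harmonic, strictly so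
for `x ≤ k`, where the errors of the single steps live.  When the coefficient of `N n x` is
negative, the recursion gives nothing, and a direct bound `hcut` is assumed. -/
theorem node_count_close (ha : 0 < a) (hA : 0 < A) {k : ℕ} (hk : 1 ≤ k) {C : ℝ} (N : ℕ → ℕ → ℝ)
    (h0 : ∀ x, N 0 x = 0)
    (hstep : ∀ n x, |N (n + 1) x - ((1 - (x + A) / den a n) * N n x +
        inflow A (N n) x / den a n + if x = 0 then 1 / (k : ℝ) else 0)| ≤
      if x ≤ k then C / den a n else 0)
    (hcut : ∀ (n x : ℕ), den a n < x + A → (x + A) * |N (n + 1) x| ≤ C) :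
    ∃ K, ∀ n x, (x + A) * |N n x - nodeDensity a A x * (den a n / ((a + 1) * k))| ≤ K := by
  have hk0 : (0 : ℝ) < k := by exact_mod_cast hk
  have hk1 : (1 : ℝ) ≤ k := by exact_mod_cast hk
  set M := A * (A + 1) with hM
  have hMpos : 0 < M := by positivity
  have hC : 0 ≤ C := by
    have h := (abs_nonneg _).trans (hstep 0 0)
    simp only [Nat.zero_le, if_true] at h
    by_contra hC
    exact absurd (div_neg_of_neg_of_pos (not_le.mp hC) (den_pos ha 0)) (not_lt.mpr h)
  set e : ℕ → ℕ → ℝ := fun n x => N n x - nodeDensity a A x * (den a n / ((a + 1) * k)) with he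
  set m : ℕ → ℝ := fun x => min (x + 1) (k + 2) with hm
  have hm1 : ∀ x, 1 ≤ m x := fun x =>
    le_min (by linarith [(x.cast_nonneg : (0 : ℝ) ≤ x)]) (by linarith)
  set K := C + M * (a + 2) with hK
  have hKpos : 0 ≤ K := by positivity
  suffices key : ∀ n x, (x + A) * |e n x| ≤ K * m x from
    ⟨K * (k + 2), fun n x => (key n x).trans (by gcongr; exact min_le_right _ _)⟩
  have hden_le : ∀ n, 0 ≤ den a n / ((a + 1) * k) := fun n => by
    have := den_pos ha n; positivity
  intro n
  induction n with
  | zero =>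
    intro x
    have hx := mul_nodeDensity_le' ha hA x
    have hn := nodeDensity_nonneg ha hA x
    simp only [he, h0, zero_sub, abs_neg]
    rw [abs_of_nonneg (mul_nonneg hn (hden_le 0)), ← mul_assoc]
    calc (x + A) * nodeDensity a A x * (den a 0 / ((a + 1) * k)) ≤ M * 1 := by
          apply mul_le_mul hx ?_ (hden_le 0) hMpos.le
          rw [div_le_one (by positivity)]
          simp only [den, CharP.cast_eq_zero]
          nlinarith
      _ ≤ K * 1 := by simp only [hK]; nlinarith
      _ ≤ K * m x := by gcongr; exact hm1 x
  | succ n ih =>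
    intro x
    have hd := den_pos ha n
    have hxA : (0 : ℝ) < x + A := by positivity
    by_cases hcase : den a n < x + A
    · have h1 := hcut n x hcase
      have hn := nodeDensity_nonneg ha hA x
      have h2 : (x + A) * (nodeDensity a A x * (den a (n + 1) / ((a + 1) * k))) ≤ M * (a + 2) := by
        have h3 : den a (n + 1) / ((a + 1) * k) ≤ (x + A + 1) * (a + 2) := by
          rw [div_le_iff₀ (by positivity), den_succ]
          have : (x + A + (a + 1)) ≤ (x + A + 1) * (a + 2) := by nlinarith
          have h4 : 1 ≤ (a + 1) * k := by nlinarith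
          nlinarith [mul_le_mul_of_nonneg_left h4 (by positivity : 0 ≤ (x + A + 1) * (a + 2))]
        calc (x + A) * (nodeDensity a A x * (den a (n + 1) / ((a + 1) * k)))
            ≤ (x + A) * (nodeDensity a A x * ((x + A + 1) * (a + 2))) := by gcongr
          _ = ((x + A) * (x + A + 1) * nodeDensity a A x) * (a + 2) := by ring
          _ ≤ M * (a + 2) := by gcongr; exact mul_nodeDensity_le ha hA x
      calc (x + A) * |e (n + 1) x|
          ≤ (x + A) * (|N (n + 1) x| + |nodeDensity a A x * (den a (n + 1) / ((a + 1) * k))|) := by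
            gcongr; exact abs_sub _ _
        _ ≤ K * 1 := by
            rw [abs_of_nonneg (mul_nonneg hn (hden_le _)), mul_add]; linarith
        _ ≤ K * m x := by gcongr; exact hm1 x
    · push Not at hcase
      -- the density times `den a n` solves the recursion exactly
      have hexact : nodeDensity a A x * (den a (n + 1) / ((a + 1) * k)) =
          (1 - (x + A) / den a n) * (nodeDensity a A x * (den a n / ((a + 1) * k))) +
          inflow A (nodeDensity a A) x * (den a n / ((a + 1) * k)) / den a n +
          if x = 0 then 1 / (k : ℝ) else 0 := by
        have hr := nodeDensity_rec ha hA x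
        have : inflow A (nodeDensity a A) x =
          (x + A + a + 1) * nodeDensity a A x - if x = 0 then a + 1 else 0 := by linarith
        rw [this, den_succ]
        split_ifs <;> field_simp <;> ring
      have hin : |inflow A (e n) x| ≤ K * (m x - if x ≤ k then 1 else 0) := by
        cases x with
        | zero =>
          simp only [inflow, abs_zero, Nat.zero_le, if_true]
          exact mul_nonneg hKpos (by linarith [hm1 0])
        | succ x =>
          simp only [inflow, abs_mul]
          rw [abs_of_pos (by positivity)]
          refine (ih x).trans ?_
          gcongr
          simp only [hm]
          split_ifs with h
          · have : (x : ℝ) + 1 ≤ k := by exact_mod_cast h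
            push_cast
            rw [min_eq_left (by linarith), min_eq_left (by linarith)]; linarith
          · push_cast
            rw [sub_zero]
            exact min_le_min_right _ (by linarith)
      have hsplit : e (n + 1) x = (1 - (x + A) / den a n) * e n x + inflow A (e n) x / den a n +
          (N (n + 1) x - ((1 - (x + A) / den a n) * N n x +
            inflow A (N n) x / den a n + if x = 0 then 1 / (k : ℝ) else 0)) := by
        have : inflow A (e n) x = inflow A (N n) x -
            inflow A (nodeDensity a A) x * (den a n / ((a + 1) * k)) := by
          simp only [he]; rw [inflow_sub, inflow_mul_right]
        rw [this]
        simp only [he]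
        rw [hexact]; ring
      have hco : 0 ≤ 1 - (x + A) / den a n := by
        rw [sub_nonneg, div_le_one hd]; exact hcase
      have hCK : (if x ≤ k then C / den a n else 0) ≤ K * (if x ≤ k then 1 else 0) / den a n := by
        split_ifs
        · gcongr; simp only [hK, mul_one]; nlinarith
        · simp
      have habs : |e (n + 1) x| ≤ (1 - (x + A) / den a n) * |e n x| + K * m x / den a n := by
        rw [hsplit]
        refine (abs_add_le _ _).trans ?_
        refine (add_le_add (abs_add_le _ _) ((hstep n x).trans hCK)).trans ?_
        rw [abs_mul, abs_of_nonneg hco, abs_div, abs_of_pos hd]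
        have : |inflow A (e n) x| / den a n ≤ K * (m x - if x ≤ k then 1 else 0) / den a n := by
          gcongr
        have e1 : K * (m x - if x ≤ k then 1 else 0) / den a n +
          K * (if x ≤ k then 1 else 0) / den a n = K * m x / den a n := by ring
        linarith
      calc (x + A) * |e (n + 1) x|
          ≤ (x + A) * ((1 - (x + A) / den a n) * |e n x| + K * m x / den a n) := by gcongr
        _ = (1 - (x + A) / den a n) * ((x + A) * |e n x|) + (x + A) / den a n * (K * m x) := by
            ring
        _ ≤ (1 - (x + A) / den a n) * (K * m x) + (x + A) / den a n * (K * m x) := by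
            exact add_le_add (mul_le_mul_of_nonneg_left (ih x) hco) le_rfl
        _ = K * m x := by ring

/-- The maximum principle for the number `Z n x y` of edges from younger blocks of excess `x` to
older blocks of excess `y`.  The outflow rate `x + y + 2 * A` exceeds the inflow rates by at least
`2 * min 1 A`, which absorbs step errors of order `1 / den a n`. -/
theorem edge_count_close (ha : 0 < a) (hA : 0 < A) {k : ℕ} (hk : 1 ≤ k) {C C' : ℝ}
    (N : ℕ → ℕ → ℝ) (Z : ℕ → ℕ → ℕ → ℝ)
    (hN : ∀ n x, (x + A) * |N n x - nodeDensity a A x * (den a n / ((a + 1) * k))| ≤ C')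
    (h0 : ∀ x y, Z 0 x y = 0)
    (hstep : ∀ n x y, |Z (n + 1) x y - ((1 - (x + y + 2 * A) / den a n) * Z n x y +
        (inflow A (fun i => Z n i y) x + inflow A (Z n x) y +
          if x = 0 then inflow A (N n) y else 0) / den a n)| ≤ C / den a n)
    (hcut : ∀ n x y : ℕ, den a n < x + y + 2 * A → |Z (n + 1) x y| ≤ C) :
    ∃ K, ∀ n x y, |Z n x y - edgeDensity a A x y * (den a n / ((a + 1) * k))| ≤ K := by
  have hk0 : (0 : ℝ) < k := by exact_mod_cast hk
  have hk1 : (1 : ℝ) ≤ k := by exact_mod_cast hk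
  set M := 2 * (A * (A + 1)) with hM
  have hMpos : 0 < M := by positivity
  set δ := min 1 A with hδ
  have hδpos : 0 < δ := lt_min one_pos hA
  have hC : 0 ≤ C := by
    have h := (abs_nonneg _).trans (hstep 0 0 0)
    by_contra hC
    exact absurd (div_neg_of_neg_of_pos (not_le.mp hC) (den_pos ha 0)) (not_lt.mpr h)
  have hC' : 0 ≤ C' := le_trans (by positivity) (hN 0 0)
  set e : ℕ → ℕ → ℕ → ℝ :=
    fun n x y => Z n x y - edgeDensity a A x y * (den a n / ((a + 1) * k)) with he
  set K := C + M * (a + 2) + (C + C') / δ with hK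
  have hKpos : 0 ≤ K := by positivity
  have hKδ : C + C' ≤ 2 * δ * K := by
    have h1 : (C + C') / δ ≤ K := by simp only [hK]; linarith [(by positivity : 0 ≤ M * (a + 2))]
    rw [div_le_iff₀ hδpos] at h1
    nlinarith
  have hden_le : ∀ n, 0 ≤ den a n / ((a + 1) * k) := fun n => by
    have := den_pos ha n; positivity
  refine ⟨K, fun n => ?_⟩
  have hlin : ∀ x y n : ℕ, den a n ≤ (x + y + 2 * A) + (a + 1) →
      edgeDensity a A x y * (den a n / ((a + 1) * k)) ≤ M * (a + 2) := by
    intro x y n h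
    have hn := edgeDensity_nonneg ha hA x y
    have h3 : den a n / ((a + 1) * k) ≤ (x + y + 2 * A + 1) * (a + 2) := by
      rw [div_le_iff₀ (by positivity)]
      have hxy : (0 : ℝ) ≤ x + y + 2 * A := by positivity
      have : (x + y + 2 * A + (a + 1)) ≤ (x + y + 2 * A + 1) * (a + 2) := by nlinarith
      have h4 : 1 ≤ (a + 1) * k := by nlinarith
      nlinarith [mul_le_mul_of_nonneg_left h4 (by positivity : 0 ≤ (x + y + 2 * A + 1) * (a + 2))]
    calc edgeDensity a A x y * (den a n / ((a + 1) * k))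
        ≤ edgeDensity a A x y * ((x + y + 2 * A + 1) * (a + 2)) := by gcongr
      _ = ((x + y + 2 * A + 1) * edgeDensity a A x y) * (a + 2) := by ring
      _ ≤ M * (a + 2) := by gcongr; exact mul_edgeDensity_le ha hA x y
  induction n with
  | zero =>
    intro x y
    simp only [h0, zero_sub, abs_neg]
    rw [abs_of_nonneg (mul_nonneg (edgeDensity_nonneg ha hA x y) (hden_le 0))]
    have : den a 0 ≤ x + y + 2 * A + (a + 1) := by
      have : (0 : ℝ) ≤ x + y + 2 * A := by positivity
      simp only [den, CharP.cast_eq_zero]; linarith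
    refine (hlin x y 0 this).trans ?_
    have : 0 ≤ (C + C') / δ := by positivity
    simp only [hK]; linarith
  | succ n ih =>
    intro x y
    have hd := den_pos ha n
    by_cases hcase : den a n < x + y + 2 * A
    · have h1 := hcut n x y hcase
      have h2 := hlin x y (n + 1) (by rw [den_succ]; linarith)
      refine (abs_sub _ _).trans ?_
      rw [abs_of_nonneg (mul_nonneg (edgeDensity_nonneg ha hA x y) (hden_le _))]
      have : 0 ≤ (C + C') / δ := by positivity
      simp only [hK]; linarith
    · push Not at hcase
      set r := den a n / ((a + 1) * k) with hr
      have hexact : edgeDensity a A x y * (den a (n + 1) / ((a + 1) * k)) =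
          (1 - (x + y + 2 * A) / den a n) * (edgeDensity a A x y * r) +
          (inflow A (fun i => edgeDensity a A i y) x * r + inflow A (edgeDensity a A x) y * r +
            (if x = 0 then inflow A (nodeDensity a A) y else 0) * r) / den a n := by
        have hr' := edgeDensity_rec ha hA x y
        rw [← add_mul, ← add_mul, ← hr', den_succ, hr]
        field_simp; ring
      have hsplit : e (n + 1) x y = (1 - (x + y + 2 * A) / den a n) * e n x y +
          (inflow A (fun i => e n i y) x + inflow A (e n x) y +
            if x = 0 then inflow A (fun i => N n i - nodeDensity a A i * r) y else 0) / den a n +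
          (Z (n + 1) x y - ((1 - (x + y + 2 * A) / den a n) * Z n x y +
            (inflow A (fun i => Z n i y) x + inflow A (Z n x) y +
              if x = 0 then inflow A (N n) y else 0) / den a n)) := by
        simp only [he]
        rw [inflow_sub, inflow_mul_right, inflow_sub, inflow_mul_right, inflow_sub,
          inflow_mul_right, hexact]
        split_ifs <;> ring
      have hco : 0 ≤ 1 - (x + y + 2 * A) / den a n := by
        rw [sub_nonneg, div_le_one hd]; exact hcase
      have h1 := abs_inflow_le hA (fun i => ih i y) x
      have h2 := abs_inflow_le hA (fun i => ih x i) y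
      have h3 : |if x = 0 then inflow A (fun i => N n i - nodeDensity a A i * r) y else 0| ≤ C' := by
        split_ifs
        · cases y with
          | zero => simpa [inflow] using hC'
          | succ y =>
            simp only [inflow, abs_mul]
            rw [abs_of_pos (by positivity)]
            exact hN n y
        · simpa using hC'
      have h4 : |inflow A (fun i => e n i y) x + inflow A (e n x) y +
            if x = 0 then inflow A (fun i => N n i - nodeDensity a A i * r) y else 0| ≤
          (x + A - δ) * K + (y + A - δ) * K + C' :=
        (abs_add_le _ _).trans (add_le_add ((abs_add_le _ _).trans (add_le_add h1 h2)) h3)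
      change |e (n + 1) x y| ≤ K
      rw [hsplit]
      refine (abs_add_le _ _).trans ?_
      refine (add_le_add (abs_add_le _ _) (hstep n x y)).trans ?_
      rw [abs_mul, abs_of_nonneg hco, abs_div, abs_of_pos hd]
      calc (1 - (x + y + 2 * A) / den a n) * |e n x y| +
            |inflow A (fun i => e n i y) x + inflow A (e n x) y +
              if x = 0 then inflow A (fun i => N n i - nodeDensity a A i * r) y else 0| / den a n +
            C / den a n
          ≤ (1 - (x + y + 2 * A) / den a n) * K +
            ((x + A - δ) * K + (y + A - δ) * K + C') / den a n + C / den a n := by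
            gcongr; exact ih x y
        _ = K - (2 * δ * K - (C + C')) / den a n := by ring
        _ ≤ K := by
            have : 0 ≤ (2 * δ * K - (C + C')) / den a n := div_nonneg (by linarith) hd.le
            linarith
end

/-! ### Expectations on finite spaces, blocks, and attachment probabilities -/

section
variable {Ω Ω' : Type*} [Fintype Ω] [Fintype Ω']

theorem expectation_pure (ω : Ω) (f : Ω → ℝ) : expectation (PMF.pure ω) f = f ω := by
  classical
  unfold expectation
  rw [Finset.sum_eq_single ω] <;> simp +contextual [PMF.pure_apply]

theorem expectation_bind (P : PMF Ω) (g : Ω → PMF Ω') (f : Ω' → ℝ) :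
    expectation (P.bind g) f = expectation P fun ω => expectation (g ω) f := by
  unfold expectation
  simp only [PMF.bind_apply, tsum_fintype]
  have h : ∀ x, (∑ ω, P ω * g ω x).toReal = ∑ ω, (P ω).toReal * (g ω x).toReal := fun x => by
    rw [ENNReal.toReal_sum fun ω _ => ENNReal.mul_ne_top (P.apply_ne_top ω) ((g ω).apply_ne_top x)]
    simp
  simp only [h, Finset.sum_mul, Finset.mul_sum]
  rw [Finset.sum_comm]
  simp [mul_assoc]

theorem expectation_map (P : PMF Ω) (g : Ω → Ω') (f : Ω' → ℝ) :
    expectation (P.map g) f = expectation P fun ω => f (g ω) := by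
  rw [← PMF.bind_pure_comp, expectation_bind]
  simp [expectation_pure]

theorem expectation_add (P : PMF Ω) (f g : Ω → ℝ) :
    expectation P (fun ω => f ω + g ω) = expectation P f + expectation P g := by
  simp [expectation, mul_add, Finset.sum_add_distrib]

theorem expectation_sub (P : PMF Ω) (f g : Ω → ℝ) :
    expectation P (fun ω => f ω - g ω) = expectation P f - expectation P g := by
  simp [expectation, mul_sub, Finset.sum_sub_distrib]

theorem expectation_const_mul (P : PMF Ω) (c : ℝ) (f : Ω → ℝ) :
    expectation P (fun ω => c * f ω) = c * expectation P f := by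
  simp only [expectation, Finset.mul_sum]
  exact Finset.sum_congr rfl fun _ _ => by ring

theorem expectation_div_const (P : PMF Ω) (f : Ω → ℝ) (c : ℝ) :
    expectation P (fun ω => f ω / c) = expectation P f / c := by
  simp only [div_eq_inv_mul, expectation_const_mul]

theorem expectation_const (P : PMF Ω) (c : ℝ) : expectation P (fun _ => c) = c := by
  have h : ∑ ω, (P ω).toReal = 1 := by
    rw [← ENNReal.toReal_sum fun ω _ => P.apply_ne_top ω, ← tsum_fintype (L := .unconditional _),
      P.tsum_coe, ENNReal.toReal_one]
  simp [expectation, ← Finset.sum_mul, h]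

theorem expectation_mono (P : PMF Ω) {f g : Ω → ℝ} (h : ∀ ω, f ω ≤ g ω) :
    expectation P f ≤ expectation P g :=
  Finset.sum_le_sum fun ω _ => mul_le_mul_of_nonneg_left (h ω) ENNReal.toReal_nonneg

theorem abs_expectation_le (P : PMF Ω) (f : Ω → ℝ) :
    |expectation P f| ≤ expectation P fun ω => |f ω| :=
  (Finset.abs_sum_le_sum_abs _ _).trans_eq <|
    Finset.sum_congr rfl fun ω _ => by rw [abs_mul, abs_of_nonneg ENNReal.toReal_nonneg]

theorem expectation_inflow (P : PMF Ω) (A : ℝ) (f : Ω → ℕ → ℝ) (x : ℕ) :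
    expectation P (fun ω => inflow A (f ω) x) =
      inflow A (fun i => expectation P fun ω => f ω i) x := by
  cases x with
  | zero => exact expectation_const P 0
  | succ x => exact expectation_const_mul P _ _

end

/-- The graph obtained from `γ` by sending the edge of the new node to `s`. -/
abbrev TargetMap.extend {n : ℕ} (γ : TargetMap n) (s : Fin (n + 1)) : TargetMap (n + 1) :=
  Fin.snoc (α := fun i : Fin (n + 1) => Fin (i.val + 1)) γ s

theorem expectation_onePerNode_succ {a : ℝ} (ha : 0 < a) (n : ℕ) (f : TargetMap (n + 1) → ℝ) :
    expectation (onePerNode a ha (n + 1)) f =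
      expectation (onePerNode a ha n) fun γ => ∑ s, stepProb a γ s * f (γ.extend s) := by
  rw [onePerNode, expectation_bind]
  simp only [expectation_map]
  congr 1
  funext γ
  refine Finset.sum_congr rfl fun s _ => ?_
  rw [stepPMF, PMF.ofFintype_apply, ENNReal.toReal_ofReal (stepProb_nonneg ha γ s)]

theorem sum_range_div (g : ℕ → ℝ) (n : ℕ) {k : ℕ} (hk : 0 < k) :
    ∑ i ∈ Finset.range n, g (i / k) =
      k * ∑ u ∈ Finset.range (n / k), g u + (n % k : ℕ) * g (n / k) := by
  have h : ∀ q r : ℕ, r ≤ k → ∑ i ∈ Finset.range r, g ((k * q + i) / k) = r * g q := by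
    intro q r hr
    rw [Finset.sum_congr rfl (g := fun _ => g q)]
    · simp
    · intro i hi
      have := Finset.mem_range.mp hi
      rw [Nat.mul_add_div hk, Nat.div_eq_of_lt (by omega), add_zero]
  have h2 : ∀ q : ℕ, ∑ i ∈ Finset.range (k * q), g (i / k) = k * ∑ u ∈ Finset.range q, g u := by
    intro q
    induction q with
    | zero => simp
    | succ q ih => rw [Nat.mul_succ, Finset.sum_range_add, ih, h q k le_rfl, Finset.sum_range_succ,
        mul_add]
  conv_lhs => rw [← Nat.div_add_mod n k]
  rw [Finset.sum_range_add, h2, h _ _ (Nat.mod_lt n hk).le]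

theorem sum_fin_div (g : ℕ → ℝ) (n : ℕ) {k : ℕ} (hk : 0 < k) :
    ∑ i : Fin n, g (i / k) =
      k * ∑ u ∈ Finset.range (n / k), g u + (n % k : ℕ) * g (n / k) := by
  rw [← sum_range_div g n hk, Finset.sum_range]

/-- Block `u` consists of the nodes `i` with `i / k = u`; it has `k` nodes once it is complete. -/
theorem card_block {n k u : ℕ} (hk : 0 < k) (hu : u < n / k) :
    ∑ i : Fin n, (if (i : ℕ) / k = u then (1 : ℝ) else 0) = k := by
  rw [sum_fin_div (fun v => if v = u then (1 : ℝ) else 0) n hk]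
  simp [hu, hu.ne']

theorem card_last_block (n : ℕ) {k : ℕ} (hk : 0 < k) :
    ∑ i : Fin n, (if (i : ℕ) / k = n / k then (1 : ℝ) else 0) = (n % k : ℕ) := by
  rw [sum_fin_div (fun v => if v = n / k then (1 : ℝ) else 0) n hk]
  rw [Finset.sum_eq_zero]
  · simp
  · intro u hu
    simp [(Finset.mem_range.mp hu).ne]

theorem card_current_block (n : ℕ) {k : ℕ} (hk : 0 < k) :
    ∑ i : Fin (n + 1), (if (i : ℕ) / k = n / k then (1 : ℝ) else 0) ≤ k := by
  rw [Fin.sum_univ_castSucc]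
  simp only [Fin.val_castSucc, Fin.val_last, if_true]
  rw [card_last_block n hk]
  exact_mod_cast Nat.mod_lt n hk

/-- The number of edges that end in block `u`, counted at their older end. -/
def indegree {n : ℕ} (k : ℕ) (γ : TargetMap n) (u : ℕ) : ℕ :=
  ∑ i, if (γ i : ℕ) / k = u then 1 else 0

section
variable {n k : ℕ}

theorem TargetMap.extend_castSucc (γ : TargetMap n) (s : Fin (n + 1)) (i : Fin n) :
    (γ.extend s i.castSucc : ℕ) = γ i := by
  simp only [TargetMap.extend, Fin.snoc_castSucc]

theorem TargetMap.extend_last (γ : TargetMap n) (s : Fin (n + 1)) :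
    (γ.extend s (Fin.last n) : ℕ) = s := by
  simp only [TargetMap.extend, Fin.snoc_last]

theorem indegree_extend (γ : TargetMap n) (s : Fin (n + 1)) (u : ℕ) :
    indegree k (γ.extend s) u = indegree k γ u + if (s : ℕ) / k = u then 1 else 0 := by
  simp only [indegree, Fin.sum_univ_castSucc, γ.extend_castSucc, γ.extend_last]

theorem TargetMap.div_le (γ : TargetMap n) (i : Fin n) : (γ i : ℕ) / k ≤ i / k :=
  Nat.div_le_div_right (Nat.lt_succ_iff.mp (γ i).isLt)

theorem indegree_add_le (γ : TargetMap n) {u v : ℕ} (h : u ≠ v) :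
    indegree k γ u + indegree k γ v ≤ n := by
  rw [indegree, indegree, ← Finset.sum_add_distrib]
  refine (Finset.sum_le_card_nsmul _ _ 1 fun i _ => ?_).trans (by simp)
  split_ifs <;> simp_all

theorem indegree_le (γ : TargetMap n) (u : ℕ) : indegree k γ u ≤ n :=
  (Nat.le_add_right _ _).trans (indegree_add_le γ (Nat.succ_ne_self u).symm)

theorem indegree_eq_zero (γ : TargetMap n) {u : ℕ} (h : ∀ i < n, i / k < u) :
    indegree k γ u = 0 :=
  Finset.sum_eq_zero fun i _ => if_neg ((γ.div_le i).trans_lt (h i i.isLt)).ne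

/-- Only loops of the newest block end in it, so there are at most `k` of them. -/
theorem indegree_le_of_last (hk : 0 < k) (γ : TargetMap (n + 1)) : indegree k γ (n / k) ≤ k := by
  have h : (indegree k γ (n / k) : ℝ) ≤ k := by
    refine le_trans ?_ (card_current_block n hk)
    rw [indegree]
    push_cast
    refine Finset.sum_le_sum fun i _ => ?_
    have h1 := γ.div_le (k := k) i
    have h2 : (i : ℕ) / k ≤ n / k := Nat.div_le_div_right (Nat.lt_succ_iff.mp i.isLt)
    split_ifs <;> first | omega | norm_num
  exact_mod_cast h

theorem multiDegree_edges (γ : TargetMap n) (j : Fin n) :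
    multiDegree γ.edges j = 1 + ∑ i, if (γ i : ℕ) = j then 1 else 0 := by
  have h : ∀ i : Fin n, ((if j ∈ γ.edges i then 1 else 0) +
      (if γ.edges i = s(j, j) then 1 else 0) : ℕ) =
      (if i = j then 1 else 0) + (if (γ i : ℕ) = j then 1 else 0) := by
    intro i
    have : (γ i : ℕ) = j ↔ γ.head i = j := by simp [TargetMap.head, Fin.ext_iff]
    simp only [this, TargetMap.edges, Sym2.mem_iff, Sym2.eq_iff]
    grind
  simp only [multiDegree, Finset.card_filter, ← Finset.sum_add_distrib, h]
  simp only [Finset.sum_add_distrib]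
  simp

theorem stepProb_castSucc {a : ℝ} (γ : TargetMap n) (j : Fin n) :
    stepProb a γ j.castSucc = ((∑ i, if (γ i : ℕ) = j then (1 : ℝ) else 0) + a) / den a n := by
  simp only [stepProb, Fin.lastCases_castSucc, multiDegree_edges, den]
  push_cast
  congr 1 <;> ring

theorem stepProb_last {a : ℝ} (γ : TargetMap n) :
    stepProb a γ (Fin.last n) = a / den a n := by
  simp only [stepProb, Fin.lastCases_last, den]
  congr 1; ring

/-- The probability that the new edge ends in block `u`. -/
theorem sum_stepProb_block {a : ℝ} (γ : TargetMap n) (u : ℕ) :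
    ∑ s, stepProb a γ s * (if (s : ℕ) / k = u then 1 else 0) =
      (indegree k γ u + a * ∑ i : Fin (n + 1), if (i : ℕ) / k = u then 1 else 0) / den a n := by
  have h : (indegree k γ u : ℝ) =
      ∑ j : Fin n, (∑ i, if (γ i : ℕ) = j then (1 : ℝ) else 0) *
        (if (j : ℕ) / k = u then 1 else 0) := by
    simp only [Finset.sum_mul]
    rw [Finset.sum_comm, indegree]
    push_cast
    refine Finset.sum_congr rfl fun i _ => ?_
    rw [Finset.sum_eq_single (γ.head i)]
    · have : ((γ.head i : Fin n) : ℕ) = γ i := rfl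
      simp only [this, if_true, one_mul]
    · intro j _ hj
      rw [if_neg, zero_mul]
      intro h'
      exact hj (by simp [TargetMap.head, Fin.ext_iff, h'])
    · simp
  rw [h, Fin.sum_univ_castSucc, Fin.sum_univ_castSucc, stepProb_last]
  simp only [stepProb_castSucc, Fin.val_castSucc, Fin.val_last]
  simp only [add_div, add_mul, div_mul_eq_mul_div, Finset.sum_add_distrib, mul_add,
    ← Finset.mul_sum, ← Finset.sum_div]
  ring

end

/-! ### Counting blocks and edges by excess -/

/-- The excess of the degree of block `u` over the minimal degree `k`.  The block under
construction is given excess `0` until it is complete. -/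
def excess {n : ℕ} (k : ℕ) (γ : TargetMap n) (u : ℕ) : ℕ :=
  if u < n / k then indegree k γ u else 0

/-- The excess of block `u` just before a block completed by the new edge is given its own excess:
a complete block gains `1` if the new edge ends in it. -/
def excessNext {n : ℕ} (k : ℕ) (γ : TargetMap n) (s u : ℕ) : ℕ :=
  excess k γ u + if s / k = u ∧ u < n / k then 1 else 0

/-- The number of blocks of excess `x`, where every node counts as `1 / k` of its block. -/
noncomputable def nodeCount {n : ℕ} (k : ℕ) (γ : TargetMap n) (x : ℕ) : ℝ :=
  (∑ i : Fin n, if excess k γ (i / k) = x then 1 else 0) / k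

/-- The number of non-loop edges from a younger block of excess `x` to an older block of
excess `y`. -/
def edgeCount {n : ℕ} (k : ℕ) (γ : TargetMap n) (x y : ℕ) : ℝ :=
  ∑ i : Fin n, if (γ i : ℕ) / k < i / k ∧ excess k γ (i / k) = x ∧
    excess k γ ((γ i : ℕ) / k) = y then 1 else 0

/-- The number of loops at the block under construction, after the new edge. -/
def newestLoops {n : ℕ} (k : ℕ) (γ : TargetMap n) (s : ℕ) : ℝ :=
  indegree k γ (n / k) + if s / k = n / k then 1 else 0

section
variable {n k : ℕ}

theorem newestLoops_nonneg (γ : TargetMap n) (s : ℕ) : 0 ≤ newestLoops k γ s := by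
  unfold newestLoops; positivity

theorem excess_extend (γ : TargetMap n) (s : Fin (n + 1)) {u : ℕ} (hu : u < n / k) :
    excess k (γ.extend s) u = excessNext k γ s u := by
  have : u < (n + 1) / k := hu.trans_le (Nat.div_le_div_right n.le_succ)
  simp [excess, excessNext, hu, this, indegree_extend]

theorem excessNext_current (γ : TargetMap n) (s : ℕ) : excessNext k γ s (n / k) = 0 := by
  simp [excess, excessNext]

/-- A block of positive excess that has just been completed has a loop. -/
theorem excess_extend_current (γ : TargetMap n) (s : Fin (n + 1)) :
    excess k (γ.extend s) (n / k) = 0 ∨ 1 ≤ newestLoops k γ s := by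
  by_cases h : excess k (γ.extend s) (n / k) = 0
  · exact Or.inl h
  · right
    have h1 : 1 ≤ indegree k (γ.extend s) (n / k) := by
      unfold excess at h
      split_ifs at h <;> omega
    rw [indegree_extend] at h1
    unfold newestLoops
    exact_mod_cast h1

theorem excess_extend_current_le (hk : 0 < k) (γ : TargetMap n) (s : Fin (n + 1)) :
    excess k (γ.extend s) (n / k) ≤ k := by
  unfold excess
  split_ifs
  · exact indegree_le_of_last hk _
  · exact Nat.zero_le _

theorem excess_le_indegree (γ : TargetMap n) (u : ℕ) : excess k γ u ≤ indegree k γ u := by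
  unfold excess; split_ifs <;> omega

/-- Computing `edgeCount` after the new edge with `excessNext` is wrong only for the edges of the
newest block, and only if that block has a loop. -/
theorem abs_edgeCount_extend_sub_le (hk : 0 < k) (γ : TargetMap n) (s : Fin (n + 1)) (x y : ℕ) :
    |edgeCount k (γ.extend s) x y -
      (∑ i : Fin n, (if (γ i : ℕ) / k < i / k ∧ excessNext k γ s (i / k) = x ∧
          excessNext k γ s ((γ i : ℕ) / k) = y then 1 else 0) +
        if (s : ℕ) / k < n / k ∧ x = 0 ∧ excessNext k γ s (s / k) = y then 1 else 0)| ≤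
      k * newestLoops k γ s := by
  have hlast : (if (s : ℕ) / k < n / k ∧ x = 0 ∧ excessNext k γ s (s / k) = y then (1 : ℝ) else 0) =
      if (s : ℕ) / k < n / k ∧ excessNext k γ s (n / k) = x ∧ excessNext k γ s (s / k) = y
        then 1 else 0 := by
    simp [excessNext_current, eq_comm]
  have hsum : (∑ i : Fin n, (if (γ i : ℕ) / k < i / k ∧ excessNext k γ s (i / k) = x ∧
          excessNext k γ s ((γ i : ℕ) / k) = y then (1 : ℝ) else 0) +
        if (s : ℕ) / k < n / k ∧ x = 0 ∧ excessNext k γ s (s / k) = y then 1 else 0) =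
      ∑ i : Fin (n + 1), if (γ.extend s i : ℕ) / k < i / k ∧ excessNext k γ s (i / k) = x ∧
          excessNext k γ s ((γ.extend s i : ℕ) / k) = y then (1 : ℝ) else 0 := by
    rw [Fin.sum_univ_castSucc, hlast]
    simp only [γ.extend_castSucc, γ.extend_last, Fin.val_castSucc, Fin.val_last]
  rw [hsum, edgeCount, ← Finset.sum_sub_distrib]
  refine (Finset.abs_sum_le_sum_abs _ _).trans ?_
  have hJ := newestLoops_nonneg (k := k) γ s
  calc _ ≤ ∑ i : Fin (n + 1), (if (i : ℕ) / k = n / k then (1 : ℝ) else 0) * newestLoops k γ s := by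
        refine Finset.sum_le_sum fun i _ => ?_
        have h1 := (γ.extend s).div_le (k := k) i
        have h2 : (i : ℕ) / k ≤ n / k := Nat.div_le_div_right (Nat.lt_succ_iff.mp i.isLt)
        by_cases hc : (γ.extend s i : ℕ) / k < i / k
        · rw [excess_extend γ s (u := (γ.extend s i : ℕ) / k) (hc.trans_le h2)]
          by_cases h : (i : ℕ) / k = n / k
          · rw [h]
            rcases excess_extend_current (k := k) γ s with h0 | h0
            · rw [h0, excessNext_current, sub_self, abs_zero]
              positivity
            · simp only [if_true, one_mul]
              refine le_trans ?_ h0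
              split_ifs <;> norm_num
          · rw [excess_extend γ s (lt_of_le_of_ne h2 h), sub_self, abs_zero]
            positivity
        · simp only [hc, false_and, if_false, sub_self, abs_zero]
          positivity
    _ ≤ k * newestLoops k γ s := by
        rw [← Finset.sum_mul]
        gcongr
        exact card_current_block n hk

theorem abs_nodeCount_extend_sub_le (hk : 0 < k) (γ : TargetMap n) (s : Fin (n + 1)) (x : ℕ) :
    |nodeCount k (γ.extend s) x -
      ((∑ i : Fin n, (if excessNext k γ s (i / k) = x then 1 else 0)) / k +
        if x = 0 then 1 / (k : ℝ) else 0)| ≤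
      if x ≤ k then newestLoops k γ s else 0 := by
  have hk0 : (0 : ℝ) < k := by exact_mod_cast hk
  have hJ := newestLoops_nonneg (k := k) γ s
  have hsum : (∑ i : Fin n, (if excessNext k γ s (i / k) = x then (1 : ℝ) else 0)) / k +
        (if x = 0 then 1 / (k : ℝ) else 0) =
      (∑ i : Fin (n + 1), if excessNext k γ s (i / k) = x then (1 : ℝ) else 0) / k := by
    rw [Fin.sum_univ_castSucc]
    simp only [Fin.val_castSucc, Fin.val_last, excessNext_current, add_div, eq_comm (a := 0)]
    split_ifs <;> simp
  rw [hsum, nodeCount, ← sub_div, ← Finset.sum_sub_distrib, abs_div, abs_of_pos hk0,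
    div_le_iff₀ hk0, mul_comm]
  refine (Finset.abs_sum_le_sum_abs _ _).trans ?_
  calc _ ≤ ∑ i : Fin (n + 1), (if (i : ℕ) / k = n / k then (1 : ℝ) else 0) *
          (if x ≤ k then newestLoops k γ s else 0) := by
        refine Finset.sum_le_sum fun i _ => ?_
        have h2 : (i : ℕ) / k ≤ n / k := Nat.div_le_div_right (Nat.lt_succ_iff.mp i.isLt)
        have hpos : 0 ≤ if x ≤ k then newestLoops k γ s else 0 := by split_ifs <;> simp [hJ]
        by_cases h : (i : ℕ) / k = n / k
        · rw [h]
          rcases excess_extend_current (k := k) γ s with h0 | h0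
          · rw [h0, excessNext_current, sub_self, abs_zero]
            positivity
          · have hle := excess_extend_current_le hk γ s
            rw [excessNext_current]
            by_cases hx : x ≤ k
            · simp only [if_true, one_mul, hx]
              refine le_trans ?_ h0
              split_ifs <;> norm_num
            · rw [if_neg (by omega), if_neg (by omega), if_neg hx]; simp
        · rw [excess_extend γ s (lt_of_le_of_ne h2 h), sub_self, abs_zero]
          positivity
    _ ≤ k * (if x ≤ k then newestLoops k γ s else 0) := by
        rw [← Finset.sum_mul]
        have hpos : 0 ≤ if x ≤ k then newestLoops k γ s else 0 := by split_ifs <;> simp [hJ]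
        gcongr
        exact card_current_block n hk

variable {a : ℝ}

/-- The rate at which the new edge hits a complete block; `0` for the block under construction. -/
def hitRate (a : ℝ) (k : ℕ) (γ : TargetMap n) (u : ℕ) : ℝ :=
  if u < n / k then excess k γ u + k * a else 0

theorem sum_stepProb_hit (hk : 0 < k) (γ : TargetMap n) (u : ℕ) :
    ∑ s, stepProb a γ s * (if (s : ℕ) / k = u ∧ u < n / k then 1 else 0) =
      hitRate a k γ u / den a n := by
  unfold hitRate excess
  by_cases hu : u < n / k
  · simp only [hu, and_true, if_true]
    rw [sum_stepProb_block, card_block hk (hu.trans_le (Nat.div_le_div_right n.le_succ)), mul_comm a]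
  · simp [hu]

theorem sum_stepProb_newestLoops_le (ha : 0 < a) (hk : 0 < k) (γ : TargetMap n) :
    ∑ s, stepProb a γ s * newestLoops k γ s ≤
      indegree k γ (n / k) + (k + k * a) / den a n := by
  have hd := den_pos ha n
  simp only [newestLoops, mul_add, Finset.sum_add_distrib, ← Finset.sum_mul, sum_stepProb ha γ,
    one_mul]
  rw [sum_stepProb_block, mul_comm (k : ℝ) a]
  gcongr
  · have h := indegree_le_of_last hk (γ.extend (Fin.last n))
    rw [indegree_extend] at h
    omega
  · exact card_current_block n hk

/-- The transition of a function of the excesses of two distinct blocks. -/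
theorem sum_stepProb_pair (ha : 0 < a) (hk : 0 < k) (γ : TargetMap n) {u v : ℕ} (huv : u ≠ v)
    (F : ℕ → ℕ → ℝ) :
    ∑ s, stepProb a γ s * F (excessNext k γ s u) (excessNext k γ s v) =
      F (excess k γ u) (excess k γ v) +
      (hitRate a k γ u * (F (excess k γ u + 1) (excess k γ v) - F (excess k γ u) (excess k γ v)) +
       hitRate a k γ v * (F (excess k γ u) (excess k γ v + 1) - F (excess k γ u) (excess k γ v)))
        / den a n := by
  have h : ∀ s : Fin (n + 1), F (excessNext k γ s u) (excessNext k γ s v) =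
      F (excess k γ u) (excess k γ v) +
      ((if (s : ℕ) / k = u ∧ u < n / k then 1 else 0) *
        (F (excess k γ u + 1) (excess k γ v) - F (excess k γ u) (excess k γ v)) +
       (if (s : ℕ) / k = v ∧ v < n / k then 1 else 0) *
        (F (excess k γ u) (excess k γ v + 1) - F (excess k γ u) (excess k γ v))) := by
    intro s
    unfold excessNext
    by_cases h1 : (s : ℕ) / k = u ∧ u < n / k <;> by_cases h2 : (s : ℕ) / k = v ∧ v < n / k
    · exact absurd (h1.1.symm.trans h2.1) huv
    · rw [if_pos h1, if_neg h2, if_pos h1, if_neg h2, add_zero]; ring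
    · rw [if_neg h1, if_pos h2, if_neg h1, if_pos h2, add_zero]; ring
    · rw [if_neg h1, if_neg h2, if_neg h1, if_neg h2, add_zero, add_zero]; ring
  simp only [h, mul_add, Finset.sum_add_distrib, ← mul_assoc, ← Finset.sum_mul, sum_stepProb ha γ,
    sum_stepProb_hit hk]
  ring

theorem sum_stepProb_single (ha : 0 < a) (hk : 0 < k) (γ : TargetMap n) (u : ℕ) (F : ℕ → ℝ) :
    ∑ s, stepProb a γ s * F (excessNext k γ s u) =
      F (excess k γ u) +
        hitRate a k γ u * (F (excess k γ u + 1) - F (excess k γ u)) / den a n := by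
  have h := sum_stepProb_pair ha hk γ (Nat.succ_ne_self u).symm (fun x _ => F x)
  simpa using h

theorem hitRate_mul_of_lt (γ : TargetMap n) {u : ℕ} (hu : u < n / k) (x : ℕ) :
    hitRate a k γ u * (if excess k γ u + 1 = x then 1 else 0) =
      inflow (k * a) (fun i => if excess k γ u = i then 1 else 0) x := by
  rw [hitRate, if_pos hu]
  cases x with
  | zero => simp [inflow]
  | succ x => by_cases h0 : excess k γ u = x <;> simp [inflow, h0]

/-- For a complete block the hit rate turns the gain into an inflow.  For the block under
construction, of excess `0`, both sides differ by at most `2 * (k * a)`, and only at `x ≤ 1`. -/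
theorem abs_hitRate_sub_le (ha : 0 < a) (hk : 0 < k) (γ : TargetMap n) {u : ℕ} (hu : u ≤ n / k)
    (x : ℕ) :
    |hitRate a k γ u *
        ((if excess k γ u + 1 = x then 1 else 0) - if excess k γ u = x then 1 else 0) -
      (inflow (k * a) (fun i => if excess k γ u = i then 1 else 0) x -
        (x + k * a) * if excess k γ u = x then 1 else 0)| ≤
      (if x ≤ k then 2 * (k * a) else 0) * if u = n / k then 1 else 0 := by
  have hka : (0 : ℝ) < k * a := by positivity
  rcases hu.lt_or_eq with h | h
  · rw [if_neg h.ne, mul_zero, mul_sub, hitRate_mul_of_lt γ h, hitRate, if_pos h]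
    refine le_of_eq (abs_eq_zero.mpr ?_)
    by_cases h0 : excess k γ u = x <;> simp [h0]
  · have he : excess k γ u = 0 := by simp [excess, h]
    simp only [hitRate, h, lt_irrefl, if_false, zero_mul, if_true, mul_one, zero_sub, abs_neg]
    rw [← h, he]
    rcases x with _ | _ | x
    · simp only [inflow, Nat.zero_le, if_true]
      rw [abs_sub_comm]; simp [abs_of_pos ha]; linarith
    · simp [inflow, abs_of_pos ha, Nat.one_le_iff_ne_zero, hk.ne']; linarith
    · simp [inflow]; split_ifs <;> positivity

end

/-! ### The recursions for one step -/

section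
variable {n k : ℕ} {a : ℝ}

/-- An edge between two complete blocks follows the recursion exactly; an edge of the block under
construction does so up to `2 * (k * a) / den a n`. -/
theorem abs_sum_stepProb_edge_le (ha : 0 < a) (hk : 0 < k) (γ : TargetMap n) (i : Fin n)
    (x y : ℕ) (T : ℕ → ℕ → ℝ)
    (hT : T = fun x y => if (γ i : ℕ) / k < i / k ∧ excess k γ (i / k) = x ∧
      excess k γ ((γ i : ℕ) / k) = y then 1 else 0) :
    |∑ s, stepProb a γ s * (if (γ i : ℕ) / k < i / k ∧ excessNext k γ s (i / k) = x ∧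
          excessNext k γ s ((γ i : ℕ) / k) = y then 1 else 0) -
      ((1 - (x + y + 2 * (k * a)) / den a n) * T x y +
        (inflow (k * a) (fun j => T j y) x + inflow (k * a) (T x) y) / den a n)| ≤
      2 * (k * a) / den a n * if (i : ℕ) / k = n / k then 1 else 0 := by
  have hd := den_pos ha n
  have hka : (0 : ℝ) < k * a := by positivity
  by_cases hc : (γ i : ℕ) / k < i / k
  · set u := (i : ℕ) / k with hu
    set v := (γ i : ℕ) / k with hv
    have hun : u ≤ n / k := Nat.div_le_div_right i.isLt.le
    have hvn : v < n / k := hc.trans_le hun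
    set X : ℕ → ℝ := fun x => if excess k γ u = x then 1 else 0 with hX
    set Y : ℕ → ℝ := fun y => if excess k γ v = y then 1 else 0 with hY
    have hTXY : T = fun x y => X x * Y y := by
      rw [hT]; funext x y; simp only [hc, true_and, hX, hY]
      split_ifs <;> simp_all
    have hpair := sum_stepProb_pair ha hk γ hc.ne'
      (fun p q => (if p = x then (1 : ℝ) else 0) * if q = y then 1 else 0)
    have hcong : ∀ s : Fin (n + 1), (if v < u ∧ excessNext k γ s u = x ∧
          excessNext k γ s v = y then (1 : ℝ) else 0) =
        (if excessNext k γ s u = x then (1 : ℝ) else 0) *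
          if excessNext k γ s v = y then 1 else 0 := by
      intro s; simp only [hc, true_and]; split_ifs <;> simp_all
    simp only [hcong, hpair]
    have e1 : inflow (k * a) (fun j => T j y) x = inflow (k * a) X x * Y y := by
      rw [hTXY, inflow_mul_right]
    have e2 : inflow (k * a) (T x) y = inflow (k * a) Y y * X x := by
      rw [hTXY]; simp only [mul_comm (X x)]; rw [inflow_mul_right]
    have h1 := abs_hitRate_sub_le ha hk γ hun x
    have h2 := abs_hitRate_sub_le ha hk γ hvn.le y
    rw [if_neg hvn.ne, mul_zero] at h2
    have h2' : hitRate a k γ v * ((if excess k γ v + 1 = y then 1 else 0) - Y y) =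
        inflow (k * a) Y y - (y + k * a) * Y y := sub_eq_zero.mp (abs_nonpos_iff.mp h2)
    have hYabs : |Y y| ≤ 1 := by simp only [hY]; split_ifs <;> simp
    rw [e1, e2, hTXY]
    have hrw : ∀ p q r s : ℝ, X x * Y y + (hitRate a k γ u * (p * Y y - X x * Y y) +
        hitRate a k γ v * (X x * q - X x * Y y)) / den a n -
        ((1 - (x + y + 2 * (k * a)) / den a n) * (X x * Y y) + (r * Y y + s * X x) / den a n) =
        ((hitRate a k γ u * (p - X x) - (r - (x + k * a) * X x)) * Y y +
          (hitRate a k γ v * (q - Y y) - (s - (y + k * a) * Y y)) * X x) / den a n := by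
      intros; ring
    rw [hrw, h2', sub_self, zero_mul, add_zero, abs_div, abs_of_pos hd, abs_mul, div_mul_eq_mul_div]
    refine div_le_div_of_nonneg_right ((mul_le_of_le_one_right (abs_nonneg _) hYabs).trans
      (h1.trans ?_)) hd.le
    gcongr
    split_ifs <;> [exact le_rfl; positivity]
  · have h0 : ∀ x y, T x y = 0 := fun x y => by rw [hT]; simp [hc]
    have e1 : inflow (k * a) (fun j => T j y) x = 0 := by cases x <;> simp [inflow, h0]
    have e2 : inflow (k * a) (T x) y = 0 := by cases y <;> simp [inflow, h0]
    rw [e1, e2, h0]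
    simp only [hc, false_and, if_false, mul_zero, Finset.sum_const_zero, add_zero, zero_div,
      sub_zero, abs_zero]
    positivity

/-- The new edge joins the block under construction to a complete block of excess `y - 1`. -/
theorem abs_sum_stepProb_newEdge_le (ha : 0 < a) (hk : 0 < k) (γ : TargetMap n) (x y : ℕ) :
    |∑ s, stepProb a γ s * (if (s : ℕ) / k < n / k ∧ x = 0 ∧
          excessNext k γ s ((s : ℕ) / k) = y then 1 else 0) -
      (if x = 0 then inflow (k * a) (nodeCount k γ) y else 0) / den a n| ≤ k * a / den a n := by
  have hd := den_pos ha n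
  have hka : (0 : ℝ) < k * a := by positivity
  have hk0 : (0 : ℝ) < k := by exact_mod_cast hk
  by_cases hx : x = 0
  · simp only [hx, true_and, if_true]
    have h1 : ∀ s : Fin (n + 1), (if (s : ℕ) / k < n / k ∧
        excessNext k γ s ((s : ℕ) / k) = y then (1 : ℝ) else 0) =
        ∑ u ∈ Finset.range (n / k), (if (s : ℕ) / k = u ∧ u < n / k then 1 else 0) *
          (if excess k γ u + 1 = y then 1 else 0) := by
      intro s
      by_cases hs : (s : ℕ) / k < n / k
      · rw [Finset.sum_eq_single ((s : ℕ) / k)]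
        · simp [hs, excessNext]
        · intro u _ hu; rw [if_neg (fun h : _ ∧ _ => hu h.1.symm), zero_mul]
        · intro h; exact absurd (Finset.mem_range.mpr hs) h
      · rw [if_neg (fun h => hs h.1), Finset.sum_eq_zero]
        intro u _
        rw [if_neg (fun h : (s : ℕ) / k = u ∧ u < n / k => hs (h.1 ▸ h.2)), zero_mul]
    simp only [h1, Finset.mul_sum]
    rw [Finset.sum_comm]
    have h2 : ∀ u ∈ Finset.range (n / k), ∑ s : Fin (n + 1), stepProb a γ s *
          ((if (s : ℕ) / k = u ∧ u < n / k then 1 else 0) *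
          (if excess k γ u + 1 = y then 1 else 0)) =
        inflow (k * a) (fun i => if excess k γ u = i then 1 else 0) y / den a n := by
      intro u hu
      rw [← hitRate_mul_of_lt γ (Finset.mem_range.mp hu)]
      simp only [← mul_assoc, ← Finset.sum_mul]
      rw [sum_stepProb_hit hk]; ring
    rw [Finset.sum_congr rfl h2, ← Finset.sum_div]
    have h3 : inflow (k * a) (nodeCount k γ) y =
        ∑ u ∈ Finset.range (n / k), inflow (k * a) (fun i => if excess k γ u = i then 1 else 0) y +
        (n % k : ℕ) / k * inflow (k * a) (fun i => if 0 = i then 1 else 0) y := by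
      have : nodeCount k γ = fun x => (∑ i : Fin n, if excess k γ (i / k) = x then 1 else 0) *
          (k : ℝ)⁻¹ := by funext x; rw [nodeCount, div_eq_mul_inv]
      rw [this, inflow_mul_right, inflow_sum Finset.univ
        (fun (i : Fin n) x => if excess k γ (i / k) = x then 1 else 0),
        sum_fin_div (fun u => inflow (k * a) (fun x => if excess k γ u = x then 1 else 0) y) n hk]
      have he : excess k γ (n / k) = 0 := by simp [excess]
      rw [he]; field_simp
    have h4 : |inflow (k * a) (fun i => if 0 = i then 1 else 0) y| ≤ k * a := by
      rcases y with _ | _ | y <;> simp [inflow, abs_of_pos ha] <;> positivity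
    have h5 : ((n % k : ℕ) : ℝ) / k ≤ 1 := by
      rw [div_le_one hk0]; exact_mod_cast (Nat.mod_lt n hk).le
    rw [h3, ← sub_div, sub_add_cancel_left, abs_div, abs_of_pos hd, abs_neg, abs_mul,
      abs_of_nonneg (by positivity : (0 : ℝ) ≤ (n % k : ℕ) / k)]
    exact div_le_div_of_nonneg_right ((mul_le_of_le_one_left (abs_nonneg _) h5).trans h4) hd.le
  · simp only [hx, false_and, and_false, if_false, mul_zero, Finset.sum_const_zero, zero_div,
      sub_zero, abs_zero]
    positivity

theorem abs_sum_stepProb_mul_le (ha : 0 < a) (γ : TargetMap n) (f : Fin (n + 1) → ℝ) :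
    |∑ s, stepProb a γ s * f s| ≤ ∑ s, stepProb a γ s * |f s| :=
  (Finset.abs_sum_le_sum_abs _ _).trans_eq <|
    Finset.sum_congr rfl fun s _ => by rw [abs_mul, abs_of_nonneg (stepProb_nonneg ha γ s)]

/-- The conditional expectation of `edgeCount` after one step. -/
theorem abs_sum_stepProb_edgeCount_le (ha : 0 < a) (hk : 0 < k) (γ : TargetMap n) (x y : ℕ) :
    |∑ s, stepProb a γ s * edgeCount k (γ.extend s) x y -
      ((1 - (x + y + 2 * (k * a)) / den a n) * edgeCount k γ x y +
        (inflow (k * a) (fun i => edgeCount k γ i y) x + inflow (k * a) (edgeCount k γ x) y +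
          if x = 0 then inflow (k * a) (nodeCount k γ) y else 0) / den a n)| ≤
      k * (indegree k γ (n / k) + (k + k * a) / den a n) + (2 * (k * a) * k + k * a) / den a n := by
  have hd := den_pos ha n
  have hka : (0 : ℝ) < k * a := by positivity
  set T : Fin n → ℕ → ℕ → ℝ := fun i x y => if (γ i : ℕ) / k < i / k ∧ excess k γ (i / k) = x ∧
      excess k γ ((γ i : ℕ) / k) = y then 1 else 0 with hT
  set S : Fin (n + 1) → Fin n → ℝ := fun s i => if (γ i : ℕ) / k < i / k ∧
    excessNext k γ s (i / k) = x ∧ excessNext k γ s ((γ i : ℕ) / k) = y then 1 else 0 with hS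
  set W : Fin (n + 1) → ℝ := fun s => if (s : ℕ) / k < n / k ∧ x = 0 ∧
    excessNext k γ s ((s : ℕ) / k) = y then 1 else 0 with hW
  have hE : edgeCount k γ = fun x y => ∑ i, T i x y := rfl
  have h1 : |∑ s, stepProb a γ s * (edgeCount k (γ.extend s) x y - (∑ i, S s i + W s))| ≤
      k * (indegree k γ (n / k) + (k + k * a) / den a n) := by
    refine (abs_sum_stepProb_mul_le ha γ _).trans ?_
    calc _ ≤ ∑ s, stepProb a γ s * (k * newestLoops k γ s) := by
          refine Finset.sum_le_sum fun s _ => ?_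
          exact mul_le_mul_of_nonneg_left (abs_edgeCount_extend_sub_le hk γ s x y)
            (stepProb_nonneg ha γ s)
      _ = k * ∑ s, stepProb a γ s * newestLoops k γ s := by
          rw [Finset.mul_sum]; exact Finset.sum_congr rfl fun _ _ => by ring
      _ ≤ _ := by gcongr; exact sum_stepProb_newestLoops_le ha hk γ
  have h2 : |∑ i, (∑ s, stepProb a γ s * S s i -
      ((1 - (x + y + 2 * (k * a)) / den a n) * T i x y +
        (inflow (k * a) (fun j => T i j y) x + inflow (k * a) (T i x) y) / den a n))| ≤
      2 * (k * a) * k / den a n := by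
    refine (Finset.abs_sum_le_sum_abs _ _).trans ((Finset.sum_le_sum fun i _ =>
      abs_sum_stepProb_edge_le ha hk γ i x y (T i) rfl).trans ?_)
    rw [← Finset.mul_sum, card_last_block n hk,
      show 2 * (k * a) * k / den a n = 2 * (k * a) / den a n * k by ring]
    gcongr
    exact (Nat.mod_lt n hk).le
  have h3 := abs_sum_stepProb_newEdge_le ha hk γ x y
  have hsplit : ∑ s, stepProb a γ s * edgeCount k (γ.extend s) x y -
      ((1 - (x + y + 2 * (k * a)) / den a n) * edgeCount k γ x y +
        (inflow (k * a) (fun i => edgeCount k γ i y) x + inflow (k * a) (edgeCount k γ x) y +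
          if x = 0 then inflow (k * a) (nodeCount k γ) y else 0) / den a n) =
      ∑ s, stepProb a γ s * (edgeCount k (γ.extend s) x y - (∑ i, S s i + W s)) +
      ∑ i, (∑ s, stepProb a γ s * S s i -
      ((1 - (x + y + 2 * (k * a)) / den a n) * T i x y +
        (inflow (k * a) (fun j => T i j y) x + inflow (k * a) (T i x) y) / den a n)) +
      (∑ s, stepProb a γ s * W s -
        (if x = 0 then inflow (k * a) (nodeCount k γ) y else 0) / den a n) := by
    have e1 : inflow (k * a) (fun i => edgeCount k γ i y) x =
        ∑ i, inflow (k * a) (fun j => T i j y) x := by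
      rw [hE, ← inflow_sum]
    have e2 : inflow (k * a) (edgeCount k γ x) y = ∑ i, inflow (k * a) (T i x) y := by
      rw [hE, ← inflow_sum]
    rw [e1, e2]
    simp only [mul_sub, mul_add, Finset.sum_sub_distrib, Finset.sum_add_distrib, hE, add_div,
      ← Finset.mul_sum, ← Finset.sum_div]
    have e3 : ∑ s, stepProb a γ s * ∑ i, S s i = ∑ i, ∑ s, stepProb a γ s * S s i := by
      simp only [Finset.mul_sum]; rw [Finset.sum_comm]
    rw [e3]; ring
  rw [hsplit]
  refine (abs_add_le _ _).trans ?_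
  refine (add_le_add ((abs_add_le _ _).trans (add_le_add h1 h2)) h3).trans_eq ?_
  ring

/-- The conditional expectation of `nodeCount` after one step. -/
theorem abs_sum_stepProb_nodeCount_le (ha : 0 < a) (hk : 0 < k) (γ : TargetMap n) (x : ℕ) :
    |∑ s, stepProb a γ s * nodeCount k (γ.extend s) x -
      ((1 - (x + k * a) / den a n) * nodeCount k γ x + inflow (k * a) (nodeCount k γ) x / den a n +
        if x = 0 then 1 / (k : ℝ) else 0)| ≤
      if x ≤ k then indegree k γ (n / k) + (k + k * a) / den a n + 2 * (k * a) / den a n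
        else 0 := by
  have hd := den_pos ha n
  have hka : (0 : ℝ) < k * a := by positivity
  have hk0 : (0 : ℝ) < k := by exact_mod_cast hk
  set S : Fin (n + 1) → Fin n → ℝ := fun s i => if excessNext k γ s (i / k) = x then 1 else 0 with hS
  set T : Fin n → ℕ → ℝ := fun i x => if excess k γ (i / k) = x then 1 else 0 with hT
  set D : ℝ := if x = 0 then 1 / (k : ℝ) else 0
  have hE : nodeCount k γ = fun x => (∑ i, T i x) * (k : ℝ)⁻¹ := by
    funext x; rw [nodeCount, div_eq_mul_inv]
  have h1 : |∑ s, stepProb a γ s * (nodeCount k (γ.extend s) x - ((∑ i, S s i) / k + D))| ≤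
      if x ≤ k then indegree k γ (n / k) + (k + k * a) / den a n else 0 := by
    refine (abs_sum_stepProb_mul_le ha γ _).trans ?_
    calc _ ≤ ∑ s, stepProb a γ s * (if x ≤ k then newestLoops k γ s else 0) := by
          refine Finset.sum_le_sum fun s _ => ?_
          exact mul_le_mul_of_nonneg_left (abs_nodeCount_extend_sub_le hk γ s x)
            (stepProb_nonneg ha γ s)
      _ ≤ _ := by
          split_ifs
          · exact sum_stepProb_newestLoops_le ha hk γ
          · simp
  have h2 : |∑ i, (∑ s, stepProb a γ s * S s i - ((1 - (x + k * a) / den a n) * T i x +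
        inflow (k * a) (T i) x / den a n))| ≤
      (if x ≤ k then 2 * (k * a) / den a n else 0) * k := by
    refine (Finset.abs_sum_le_sum_abs _ _).trans ?_
    calc _ ≤ ∑ i : Fin n, (if x ≤ k then 2 * (k * a) / den a n else 0) *
          (if (i : ℕ) / k = n / k then 1 else 0) := by
          refine Finset.sum_le_sum fun i _ => ?_
          have hun : (i : ℕ) / k ≤ n / k := Nat.div_le_div_right i.isLt.le
          have h := abs_hitRate_sub_le ha hk γ hun x
          have hs := sum_stepProb_single ha hk γ (i / k) (fun p => if p = x then (1 : ℝ) else 0)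
          simp only [hS, hs]
          have : ∀ p q r : ℝ, T i x + p / den a n - ((1 - (x + k * a) / den a n) * T i x +
              q / den a n) = (p - (q - (x + k * a) * T i x)) / den a n := by
            intros; ring
          refine (le_of_eq (congrArg _ (this _ _ 0))).trans ?_
          rw [abs_div, abs_of_pos hd, div_le_iff₀ hd]
          refine h.trans_eq ?_
          split_ifs <;> simp [hd.ne']
      _ ≤ _ := by
          rw [← Finset.mul_sum, card_last_block n hk]
          gcongr
          exact (Nat.mod_lt n hk).le
  have hsplit : ∑ s, stepProb a γ s * nodeCount k (γ.extend s) x -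
      ((1 - (x + k * a) / den a n) * nodeCount k γ x + inflow (k * a) (nodeCount k γ) x / den a n +
        D) =
      ∑ s, stepProb a γ s * (nodeCount k (γ.extend s) x - ((∑ i, S s i) / k + D)) +
      (∑ i, (∑ s, stepProb a γ s * S s i - ((1 - (x + k * a) / den a n) * T i x +
        inflow (k * a) (T i) x / den a n))) / k := by
    have e1 : inflow (k * a) (nodeCount k γ) x =
        (∑ i, inflow (k * a) (T i) x) * (k : ℝ)⁻¹ := by
      rw [hE, inflow_mul_right, inflow_sum]
    rw [e1]
    simp only [mul_sub, mul_add, Finset.sum_sub_distrib, Finset.sum_add_distrib, hE,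
      ← Finset.mul_sum, ← Finset.sum_div, ← Finset.sum_mul, sum_stepProb ha γ, one_mul]
    have e3 : ∑ s, stepProb a γ s * ((∑ i, S s i) / k) =
        (∑ i, ∑ s, stepProb a γ s * S s i) / k := by
      rw [Finset.sum_comm, Finset.sum_div]
      exact Finset.sum_congr rfl fun s _ => by rw [← Finset.mul_sum]; ring
    rw [e3]; ring
  rw [hsplit]
  refine (abs_add_le _ _).trans ?_
  rw [abs_div, abs_of_pos hk0]
  have h2' := (div_le_iff₀ hk0).mpr h2
  refine (add_le_add h1 h2').trans_eq ?_
  split_ifs <;> simp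

end

/-! ### Asymptotics of the expected counts -/

section
variable {n k : ℕ} {a : ℝ}

theorem den_mono (ha : 0 < a) {m n : ℕ} (h : m ≤ n) : den a m ≤ den a n := by
  unfold den; gcongr

/-- The expected number of loops at the block under construction: each of its edges is a loop with
probability of order `1 / n`. -/
theorem expectation_indegree_last_le_aux (ha : 0 < a) (hk : 0 < k) (n : ℕ) :
    expectation (onePerNode a ha n) (fun γ => (indegree k γ (n / k) : ℝ)) ≤
      (n % k : ℕ) * ((k + k * a) / den a (k * (n / k))) := by
  induction n with
  | zero =>
    simp only [onePerNode, expectation_pure, Nat.zero_mod, CharP.cast_eq_zero, zero_mul]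
    simp [indegree]
  | succ n ih =>
    have hd := den_pos ha (k * ((n + 1) / k))
    rw [expectation_onePerNode_succ]
    by_cases hdvd : k ∣ n + 1
    · have hdiv : (n + 1) / k = n / k + 1 := Nat.succ_div_of_dvd hdvd
      have h0 : ∀ (γ : TargetMap n) (s : Fin (n + 1)),
          indegree k (γ.extend s) ((n + 1) / k) = 0 := fun γ s => by
        refine indegree_eq_zero _ fun i hi => ?_
        rw [hdiv]
        exact Nat.lt_succ_of_le (Nat.div_le_div_right (Nat.lt_succ_iff.mp hi))
      simp only [h0, CharP.cast_eq_zero, mul_zero, Finset.sum_const_zero, expectation_const]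
      positivity
    · have hdiv : (n + 1) / k = n / k := Nat.succ_div_of_not_dvd hdvd
      have hmod : (n + 1) % k = n % k + 1 := by
        have h1 := Nat.div_add_mod n k
        have h2 := Nat.div_add_mod (n + 1) k
        rw [hdiv] at h2
        omega
      have hd' := den_pos ha (k * (n / k))
      have h1 : ∀ γ : TargetMap n, ∑ s, stepProb a γ s * (indegree k (γ.extend s) (n / k) : ℝ) ≤
          indegree k γ (n / k) + (k + k * a) / den a (k * (n / k)) := by
        intro γ
        have := sum_stepProb_newestLoops_le ha hk γ
        simp only [newestLoops] at this
        simp only [indegree_extend]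
        push_cast
        refine this.trans ?_
        gcongr
        exact den_mono ha (Nat.mul_div_le n k)
      rw [hdiv, hmod]
      refine (expectation_mono _ h1).trans ?_
      rw [expectation_add, expectation_const]
      push_cast
      linarith

theorem expectation_indegree_last_le (ha : 0 < a) (hk : 0 < k) (n : ℕ) :
    expectation (onePerNode a ha n) (fun γ => (indegree k γ (n / k) : ℝ)) ≤
      k * (k + k * a) * (1 + (a + 1) * k / a) / den a n := by
  refine (expectation_indegree_last_le_aux ha hk n).trans ?_
  have hd := den_pos ha n
  have hd' := den_pos ha (k * (n / k))
  have hmod : ((n % k : ℕ) : ℝ) ≤ k := by exact_mod_cast (Nat.mod_lt n hk).le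
  have hden : den a n ≤ den a (k * (n / k)) * (1 + (a + 1) * k / a) := by
    have h1 : den a n = den a (k * (n / k)) + (a + 1) * (n % k : ℕ) := by
      conv_lhs => rw [← Nat.div_add_mod n k]
      unfold den; push_cast; ring
    have h2 : a ≤ den a (k * (n / k)) := by
      unfold den
      have : 0 ≤ (a + 1) * ((k * (n / k) : ℕ) : ℝ) := by positivity
      linarith
    have h3 : (a + 1) * k ≤ den a (k * (n / k)) * ((a + 1) * k / a) := by
      rw [mul_div_assoc', le_div_iff₀ ha, mul_comm]
      gcongr
    rw [h1, mul_add, mul_one]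
    have : (a + 1) * ((n % k : ℕ) : ℝ) ≤ (a + 1) * k := by gcongr
    linarith
  rw [mul_div_assoc', div_le_div_iff₀ hd' hd]
  calc (n % k : ℕ) * (k + k * a) * den a n
      ≤ k * (k + k * a) * (den a (k * (n / k)) * (1 + (a + 1) * k / a)) := by gcongr
    _ = _ := by ring

theorem nodeCount_nonneg (γ : TargetMap n) (x : ℕ) : 0 ≤ nodeCount k γ x :=
  div_nonneg (Finset.sum_nonneg fun i _ => by split_ifs <;> norm_num) (Nat.cast_nonneg k)

theorem edgeCount_nonneg (γ : TargetMap n) (x y : ℕ) : 0 ≤ edgeCount k γ x y :=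
  Finset.sum_nonneg fun i _ => by split_ifs <;> norm_num

theorem nodeCount_le (hk : 0 < k) (γ : TargetMap n) (x : ℕ) : nodeCount k γ x ≤ n := by
  have hk1 : (1 : ℝ) ≤ k := by exact_mod_cast hk
  have h : ∑ i : Fin n, (if excess k γ (i / k) = x then (1 : ℝ) else 0) ≤ n := by
    refine (Finset.sum_le_card_nsmul _ _ 1 fun i _ => ?_).trans (by simp)
    split_ifs <;> norm_num
  exact (div_le_self (Finset.sum_nonneg fun i _ => by split_ifs <;> norm_num) hk1).trans h

theorem edgeCount_le (γ : TargetMap n) (x y : ℕ) : edgeCount k γ x y ≤ n := by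
  refine (Finset.sum_le_card_nsmul _ _ 1 fun i _ => ?_).trans (by simp)
  split_ifs <;> norm_num

theorem nodeCount_eq_zero (γ : TargetMap n) {x : ℕ} (h : n < x) : nodeCount k γ x = 0 := by
  rw [nodeCount, Finset.sum_eq_zero, zero_div]
  intro i _
  have := (excess_le_indegree (k := k) γ (i / k)).trans (indegree_le γ _)
  rw [if_neg (by omega)]

theorem edgeCount_eq_zero (γ : TargetMap n) {x y : ℕ} (h : n < x + y) :
    edgeCount k γ x y = 0 := by
  refine Finset.sum_eq_zero fun i _ => if_neg ?_
  rintro ⟨h1, h2, h3⟩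
  have := indegree_add_le (k := k) γ h1.ne'
  have := excess_le_indegree (k := k) γ (i / k)
  have := excess_le_indegree (k := k) γ ((γ i : ℕ) / k)
  omega

/-- The asymptotics of the expected number of blocks of excess `x`. -/
theorem exists_nodeCount_close (ha : 0 < a) (hk : 0 < k) :
    ∃ K, ∀ n x : ℕ, (x + k * a) * |expectation (onePerNode a ha n) (fun γ => nodeCount k γ x) -
      nodeDensity a (k * a) x * (den a n / ((a + 1) * k))| ≤ K := by
  have hk0 : (0 : ℝ) < k := by exact_mod_cast hk
  have hka : (0 : ℝ) < k * a := by positivity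
  set C₁ : ℝ := k * (k + k * a) * (1 + (a + 1) * k / a) + (k + k * a) + 2 * (k * a) with hC₁
  set C₂ : ℝ := (1 / a + k + 1 + k * a) * (1 / a + k + 1) with hC₂
  have hC₁p : 0 ≤ C₁ := by positivity
  have hC₂p : 0 ≤ C₂ := by positivity
  refine node_count_close ha hka hk (C := C₁ + C₂)
    (fun n x => expectation (onePerNode a ha n) fun γ => nodeCount k γ x) ?_ ?_ ?_
  · intro x
    simp only [onePerNode, expectation_pure]
    simp [nodeCount]
  · intro n x
    have hd := den_pos ha n
    rw [expectation_onePerNode_succ]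
    have h1 := abs_expectation_le (onePerNode a ha n) (fun γ =>
      ∑ s, stepProb a γ s * nodeCount k (γ.extend s) x -
      ((1 - (x + k * a) / den a n) * nodeCount k γ x + inflow (k * a) (nodeCount k γ) x / den a n +
        if x = 0 then 1 / (k : ℝ) else 0))
    have h2 := h1.trans (expectation_mono _ fun γ => abs_sum_stepProb_nodeCount_le ha hk γ x)
    rw [expectation_sub, expectation_add, expectation_add, expectation_const_mul,
      expectation_div_const, expectation_inflow, expectation_const] at h2
    refine h2.trans ?_
    split_ifs
    · rw [expectation_add, expectation_add, expectation_const, expectation_const]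
      have := expectation_indegree_last_le ha hk n
      have h3 : C₁ / den a n ≤ (C₁ + C₂) / den a n := by gcongr; linarith
      refine le_trans ?_ h3
      simp only [hC₁, add_div] at this ⊢
      linarith
    · rw [expectation_const]
  · intro n x hx
    have hpath : ∀ γ : TargetMap (n + 1), (x + k * a) * nodeCount k γ x ≤ C₁ + C₂ := by
      intro γ
      by_cases hxn : n + 1 < x
      · rw [nodeCount_eq_zero γ hxn, mul_zero]; positivity
      · have hxn' : (x : ℝ) ≤ n + 1 := by exact_mod_cast not_lt.mp hxn
        have hn : (n : ℝ) ≤ 1 / a + k := by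
          unfold den at hx
          rw [div_add' _ _ _ ha.ne', le_div_iff₀ ha]
          linarith
        have := nodeCount_le hk γ x
        push_cast at this
        have : (x + k * a) * nodeCount k γ x ≤ C₂ := by
          apply mul_le_mul _ _ (nodeCount_nonneg γ x) (by positivity) <;> linarith
        linarith
    rw [abs_of_nonneg ((expectation_const (onePerNode a ha (n + 1)) 0).symm.le.trans
      (expectation_mono _ fun γ => nodeCount_nonneg γ x)), ← expectation_const_mul]
    exact (expectation_mono _ hpath).trans_eq (expectation_const _ _)

/-- The asymptotics of the expected number of edges from younger blocks of excess `x` to older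
blocks of excess `y`. -/
theorem exists_edgeCount_close (ha : 0 < a) (hk : 0 < k) :
    ∃ K, ∀ n x y : ℕ, |expectation (onePerNode a ha n) (fun γ => edgeCount k γ x y) -
      edgeDensity a (k * a) x y * (den a n / ((a + 1) * k))| ≤ K := by
  have hk0 : (0 : ℝ) < k := by exact_mod_cast hk
  have hka : (0 : ℝ) < k * a := by positivity
  obtain ⟨K, hK⟩ := exists_nodeCount_close ha hk
  set C₁ : ℝ := k * (k * (k + k * a) * (1 + (a + 1) * k / a)) + k * (k + k * a) +
    (2 * (k * a) * k + k * a) with hC₁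
  set C₂ : ℝ := (1 + 2 * (k * a)) / a + 1 with hC₂
  have hC₁p : 0 ≤ C₁ := by positivity
  have hC₂p : 0 ≤ C₂ := by positivity
  refine edge_count_close ha hka hk (C := C₁ + C₂) _
    (fun n x y => expectation (onePerNode a ha n) fun γ => edgeCount k γ x y) hK ?_ ?_ ?_
  · intro x y
    simp only [onePerNode, expectation_pure]
    simp [edgeCount]
  · intro n x y
    have hd := den_pos ha n
    rw [expectation_onePerNode_succ]
    have h1 := abs_expectation_le (onePerNode a ha n) (fun γ =>
      ∑ s, stepProb a γ s * edgeCount k (γ.extend s) x y -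
      ((1 - (x + y + 2 * (k * a)) / den a n) * edgeCount k γ x y +
        (inflow (k * a) (fun i => edgeCount k γ i y) x + inflow (k * a) (edgeCount k γ x) y +
          if x = 0 then inflow (k * a) (nodeCount k γ) y else 0) / den a n))
    have h2 := h1.trans (expectation_mono _ fun γ => abs_sum_stepProb_edgeCount_le ha hk γ x y)
    have hif : expectation (onePerNode a ha n)
        (fun γ => if x = 0 then inflow (k * a) (nodeCount k γ) y else 0) =
        if x = 0 then inflow (k * a) (fun i => expectation (onePerNode a ha n)
          fun γ => nodeCount k γ i) y else 0 := by
      split_ifs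
      · exact expectation_inflow _ _ _ _
      · exact expectation_const _ _
    rw [expectation_sub, expectation_add, expectation_const_mul,
      expectation_div_const, expectation_add, expectation_add, expectation_inflow,
      expectation_inflow, hif, expectation_add, expectation_const_mul, expectation_add,
      expectation_const, expectation_const] at h2
    refine h2.trans ?_
    have := mul_le_mul_of_nonneg_left (expectation_indegree_last_le ha hk n) hk0.le
    have h3 : C₁ / den a n ≤ (C₁ + C₂) / den a n := by gcongr; linarith
    refine le_trans ?_ h3
    rw [mul_div_assoc'] at this
    simp only [hC₁, add_div, mul_add, mul_div_assoc'] at this ⊢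
    linarith
  · intro n x y hxy
    have hpath : ∀ γ : TargetMap (n + 1), edgeCount k γ x y ≤ C₁ + C₂ := by
      intro γ
      by_cases hxn : n + 1 < x + y
      · rw [edgeCount_eq_zero γ hxn]; positivity
      · have hxn' : (x : ℝ) + y ≤ n + 1 := by exact_mod_cast not_lt.mp hxn
        have hn : (n : ℝ) ≤ (1 + 2 * (k * a)) / a := by
          unfold den at hxy
          rw [le_div_iff₀ ha]
          linarith
        have := edgeCount_le (k := k) γ x y
        push_cast at this
        linarith
    rw [abs_of_nonneg ((expectation_const (onePerNode a ha (n + 1)) 0).symm.le.trans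
      (expectation_mono _ fun γ => edgeCount_nonneg γ x y))]
    exact (expectation_mono _ hpath).trans_eq (expectation_const _ _)

end

/-! ### The graph of blocks -/

section
variable {k t : ℕ} {a : ℝ}

/-- The edges of the graph in which the nodes of every block are identified. -/
def blockEdges (γ : TargetMap (t * k)) (e : Fin (t * k)) : Sym2 (Fin t) :=
  (γ.edges e).map Fin.divNat

theorem multiDegree_blockEdges (hk : 0 < k) (γ : TargetMap (t * k)) (u : Fin t) :
    multiDegree (blockEdges γ) u = k + indegree k γ u := by
  have h : ∀ i : Fin (t * k), ((if u ∈ blockEdges γ i then 1 else 0) +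
      (if blockEdges γ i = s(u, u) then 1 else 0) : ℕ) =
      (if (i : ℕ) / k = u then 1 else 0) + (if (γ i : ℕ) / k = u then 1 else 0) := by
    intro i
    have h1 : (γ i : ℕ) / k = u ↔ (γ.head i).divNat = u := by simp [TargetMap.head, Fin.ext_iff]
    have h2 : (i : ℕ) / k = u ↔ i.divNat = u := by simp [Fin.ext_iff]
    simp only [h1, h2, blockEdges, TargetMap.edges, Sym2.map_mk, Sym2.mem_iff, Sym2.eq_iff]
    grind
  simp only [multiDegree, Finset.card_filter, ← Finset.sum_add_distrib, h]
  rw [Finset.sum_add_distrib, indegree]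
  congr 1
  have := card_block (n := t * k) (k := k) (u := u) hk (by rw [Nat.mul_div_cancel _ hk]; exact u.2)
  exact_mod_cast this

/-- Every non-loop edge is counted from both of its ends. -/
theorem edgesBetweenDegrees_blockEdges (hk : 0 < k) (γ : TargetMap (t * k)) (x y : ℕ) :
    (edgesBetweenDegrees (k + x) (k + y) (blockEdges γ) : ℝ) =
      edgeCount k γ x y + edgeCount k γ y x := by
  have hex : ∀ u : Fin t, excess k γ u = indegree k γ u := fun u => by
    rw [excess, if_pos (by rw [Nat.mul_div_cancel _ hk]; exact u.2)]
  have hdeg : ∀ (u : Fin t) (x : ℕ), multiDegree (blockEdges γ) u = k + x ↔ excess k γ u = x := by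
    intro u x; rw [multiDegree_blockEdges hk, hex]; omega
  simp only [edgesBetweenDegrees, hdeg, edgeMultiplicity, Finset.card_filter]
  have hnat : (∑ u : Fin t, ∑ v ∈ Finset.univ.erase u,
      if excess k γ u = x ∧ excess k γ v = y then
        ∑ e, if blockEdges γ e = s(u, v) then 1 else 0 else 0) =
      ∑ e : Fin (t * k), ((if (γ e : ℕ) / k < e / k ∧ excess k γ (e / k) = x ∧
        excess k γ ((γ e : ℕ) / k) = y then 1 else 0) +
        if (γ e : ℕ) / k < e / k ∧ excess k γ (e / k) = y ∧
        excess k γ ((γ e : ℕ) / k) = x then 1 else 0) := by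
    have h1 : ∀ u : Fin t, (∑ v ∈ Finset.univ.erase u,
        if excess k γ u = x ∧ excess k γ v = y then
          ∑ e, if blockEdges γ e = s(u, v) then 1 else 0 else 0) =
        ∑ e, ∑ v : Fin t, if u ≠ v ∧ blockEdges γ e = s(u, v) ∧ excess k γ u = x ∧
          excess k γ v = y then 1 else 0 := by
      intro u
      rw [Finset.sum_comm, ← Finset.sum_subset (Finset.subset_univ (Finset.univ.erase u))]
      · refine Finset.sum_congr rfl fun v hv => ?_
        have huv : u ≠ v := (Finset.ne_of_mem_erase hv).symm
        by_cases h : excess k γ u = x ∧ excess k γ v = y <;> simp [h, huv]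
      · intro v _ hv
        have : v = u := by simpa using hv
        simp [this]
    simp only [h1]
    rw [Finset.sum_comm]
    refine Finset.sum_congr rfl fun e _ => ?_
    set p : Fin t := e.divNat with hp
    set q : Fin t := (γ.head e).divNat with hq
    have hE : blockEdges γ e = s(p, q) := rfl
    have hpv : (e : ℕ) / k = p := rfl
    have hqv : (γ e : ℕ) / k = q := rfl
    have hle : q ≤ p := γ.div_le (k := k) e
    rw [hE, hpv, hqv]
    have h2 : ∀ u v : Fin t, (if u ≠ v ∧ s(p, q) = s(u, v) ∧ excess k γ u = x ∧
          excess k γ v = y then 1 else 0) =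
        (if u = p then if v = q then if (q : ℕ) < p ∧ excess k γ p = x ∧ excess k γ q = y
          then 1 else 0 else 0 else 0) +
        (if u = q then if v = p then if (q : ℕ) < p ∧ excess k γ p = y ∧ excess k γ q = x
          then 1 else 0 else 0 else 0) := by
      intro u v
      have hlt : (q : ℕ) < p ↔ p ≠ q := by
        rw [Fin.lt_def.symm, lt_iff_le_and_ne]
        exact ⟨fun h => h.2.symm, fun h => ⟨hle, h.symm⟩⟩
      simp only [hlt, Sym2.eq_iff]
      by_cases h1 : u = p <;> by_cases h2 : v = q <;> by_cases h3 : u = q <;>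
        by_cases h4 : v = p <;> grind
    simp only [h2, Finset.sum_add_distrib]
    simp
  rw [hnat]
  simp only [edgeCount]
  push_cast
  rw [Finset.sum_add_distrib]

theorem expectedEdges_eq (ha : 0 < a) (hk : 0 < k) (t x y : ℕ) :
    expectedEdges a ha k (k + x) (k + y) t =
      expectation (onePerNode a ha (t * k)) (fun γ => edgeCount k γ x y) +
      expectation (onePerNode a ha (t * k)) (fun γ => edgeCount k γ y x) := by
  rw [expectedEdges, buckleyOsthus, expectation_map, ← expectation_add]
  congr 1
  funext γ
  exact edgesBetweenDegrees_blockEdges hk γ x y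

/-- The expected number of edges between blocks of excess `x` and `y` is linear in the number of
blocks, up to a bounded error. -/
theorem exists_expectedEdges_close (ha : 0 < a) (hk : 0 < k) :
    ∃ C, ∀ x y t : ℕ, |expectedEdges a ha k (k + x) (k + y) t -
      (edgeDensity a (k * a) x y + edgeDensity a (k * a) y x) * t| ≤ C := by
  have hk0 : (0 : ℝ) < k := by exact_mod_cast hk
  have hka : (0 : ℝ) < k * a := by positivity
  obtain ⟨K, hK⟩ := exists_edgeCount_close ha hk
  set M := 2 * (k * a * (k * a + 1)) with hM
  have hMpos : 0 ≤ M := by positivity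
  have hc : ∀ x y, |edgeDensity a (k * a) x y * (a / ((a + 1) * k))| ≤ M * (a / ((a + 1) * k)) := by
    intro x y
    have h0 := edgeDensity_nonneg ha hka x y
    rw [abs_of_nonneg (by positivity)]
    gcongr
    refine le_trans ?_ (mul_edgeDensity_le ha hka x y)
    have : 0 ≤ (x + y + 2 * (k * a)) * edgeDensity a (k * a) x y := by positivity
    linarith
  have h1 : ∀ x y t : ℕ, |expectation (onePerNode a ha (t * k)) (fun γ => edgeCount k γ x y) -
      edgeDensity a (k * a) x y * t| ≤ K + M * (a / ((a + 1) * k)) := by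
    intro x y t
    refine le_trans (le_of_eq (congrArg _ ?_)) ((abs_add_le _ _).trans
      (add_le_add (hK (t * k) x y) (hc x y)))
    unfold den; push_cast; field_simp; ring
  refine ⟨2 * (K + M * (a / ((a + 1) * k))), fun x y t => ?_⟩
  rw [expectedEdges_eq ha hk]
  refine le_trans (le_of_eq (congrArg _ ?_)) ((abs_add_le _ _).trans
    ((add_le_add (h1 x y t) (h1 y x t)).trans_eq (two_mul _).symm))
  ring

end

/-! ### Quotients of Gamma functions -/

section
open Filter Topology Real

theorem log_Gamma_add_one {z : ℝ} (hz : 0 < z) :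
    log (Gamma (z + 1)) = log z + log (Gamma z) := by
  rw [Gamma_add_one hz.ne', log_mul hz.ne' (Gamma_pos_of_pos hz).ne']

/-- The slope of the convex function `log Γ` on `[z, z + a]` lies between its slopes on
`[z - 1, z]` and on `[z + a, z + a + 1]`. -/
theorem rpow_le_Gamma_add_div {z a : ℝ} (hz : 1 < z) (ha : 0 < a) :
    (z - 1) ^ a ≤ Gamma (z + a) / Gamma z := by
  have h := convexOn_log_Gamma.slope_mono_adjacent (x := z - 1) (y := z) (z := z + a)
    (by simp; linarith) (by simp; linarith) (by linarith) (by linarith)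
  have h1 := log_Gamma_add_one (z := z - 1) (by linarith)
  have hg := Gamma_pos_of_pos (show 0 < z by linarith)
  have hg' := Gamma_pos_of_pos (show 0 < z + a by linarith)
  rw [sub_add_cancel] at h1
  simp only [Function.comp, sub_sub_cancel, add_sub_cancel_left, div_one] at h
  rw [h1, add_sub_cancel_right, le_div_iff₀ ha, ← h1] at h
  rw [rpow_def_of_pos (by linarith), ← exp_log (div_pos hg' hg), log_div hg'.ne' hg.ne']
  exact exp_le_exp.mpr h

theorem Gamma_add_div_le_rpow {z a : ℝ} (hz : 0 < z) (ha : 0 < a) :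
    Gamma (z + a) / Gamma z ≤ (z + a) ^ a := by
  have h := convexOn_log_Gamma.slope_mono_adjacent (x := z) (y := z + a) (z := z + a + 1)
    (by simpa) (by simp; linarith) (by linarith) (by linarith)
  have h1 := log_Gamma_add_one (z := z + a) (by linarith)
  have hg := Gamma_pos_of_pos (show 0 < z by linarith)
  have hg' := Gamma_pos_of_pos (show 0 < z + a by linarith)
  simp only [Function.comp, add_sub_cancel_left, div_one] at h
  rw [h1, add_sub_cancel_right, div_le_iff₀ ha] at h
  rw [rpow_def_of_pos (by linarith), ← exp_log (div_pos hg' hg), log_div hg'.ne' hg.ne']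
  exact exp_le_exp.mpr h

/-- The quotient `Γ(p + a) Γ(p + A) / (Γ(p) Γ(p + A + a))`. -/
noncomputable def gammaQuot (a A p : ℝ) : ℝ :=
  Gamma (p + a) * Gamma (p + A) / (Gamma p * Gamma (p + A + a))

variable {a A : ℝ}

theorem gammaQuot_pos (ha : 0 < a) (hA : 0 < A) {p : ℝ} (hp : 0 < p) : 0 < gammaQuot a A p := by
  have := Gamma_pos_of_pos hp
  have := Gamma_pos_of_pos (add_pos hp ha)
  have := Gamma_pos_of_pos (add_pos hp hA)
  have := Gamma_pos_of_pos (add_pos (add_pos hp hA) ha)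
  unfold gammaQuot; positivity

theorem gammaQuot_rec (ha : 0 < a) (hA : 0 < A) {p : ℝ} (hp : 0 < p) :
    gammaQuot a A p = gammaQuot a A (p + 1) * (1 - a * A / ((p + a) * (p + A))) := by
  have h1 := Gamma_pos_of_pos hp
  have h2 := Gamma_pos_of_pos (add_pos hp ha)
  have h3 := Gamma_pos_of_pos (add_pos hp hA)
  have h4 := Gamma_pos_of_pos (add_pos (add_pos hp hA) ha)
  unfold gammaQuot
  rw [show p + 1 + a = p + a + 1 by ring, show p + 1 + A = p + A + 1 by ring,
    show p + A + 1 + a = p + A + a + 1 by ring, Gamma_add_one hp.ne',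
    Gamma_add_one (add_pos hp ha).ne', Gamma_add_one (add_pos hp hA).ne',
    Gamma_add_one (add_pos (add_pos hp hA) ha).ne']
  have : p + a ≠ 0 := by positivity
  have : p + A ≠ 0 := by positivity
  have : p + A + a ≠ 0 := by positivity
  field_simp
  ring

theorem tendsto_gammaQuot (ha : 0 < a) (hA : 0 < A) {p : ℝ} (hp : 1 < p) :
    Tendsto (fun n : ℕ => gammaQuot a A (p + n)) atTop (𝓝 1) := by
  have hlim : ∀ b c : ℝ, Tendsto (fun n : ℕ => ((p + n + b) / (p + n + c)) ^ a) atTop (𝓝 1) := by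
    intro b c
    have h0 : Tendsto (fun n : ℕ => p + (n : ℝ) + c) atTop atTop :=
      tendsto_atTop_add_const_right _ _
        (tendsto_atTop_add_const_left _ _ tendsto_natCast_atTop_atTop)
    have h1 : Tendsto (fun n : ℕ => 1 + (b - c) / (p + n + c)) atTop (𝓝 (1 + 0)) :=
      tendsto_const_nhds.add (tendsto_const_nhds.div_atTop h0)
    rw [add_zero] at h1
    have h2 : Tendsto (fun n : ℕ => (p + n + b) / (p + n + c)) atTop (𝓝 1) := by
      refine h1.congr' ?_
      filter_upwards [h0.eventually_gt_atTop 0] with n hn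
      rw [eq_div_iff hn.ne', add_mul, div_mul_cancel₀ _ hn.ne']; ring
    have h3 := h2.rpow_const (p := a) (Or.inr ha.le)
    rwa [one_rpow] at h3
  refine tendsto_of_tendsto_of_tendsto_of_le_of_le (hlim (-1) (A + a)) (hlim a (A - 1)) ?_ ?_ <;>
    intro n <;> simp only <;>
    have hn : (0 : ℝ) ≤ n := n.cast_nonneg
  all_goals
    have hg := Gamma_pos_of_pos (show 0 < p + n + A by linarith)
    have hg' := Gamma_pos_of_pos (show 0 < p + n + A + a by linarith)
    have hq : gammaQuot a A (p + n) = (Gamma (p + n + a) / Gamma (p + n)) /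
        (Gamma (p + n + A + a) / Gamma (p + n + A)) := by
      unfold gammaQuot; field_simp
    rw [hq, div_rpow (by linarith) (by linarith)]
  · have h1 := rpow_le_Gamma_add_div (z := p + n) (by linarith) ha
    have h2 := Gamma_add_div_le_rpow (z := p + n + A) (by linarith) ha
    rw [show p + n + -1 = p + n - 1 by ring, show p + n + (A + a) = p + n + A + a by ring]
    refine div_le_div₀ ((rpow_nonneg (by linarith) _).trans h1) h1 (by positivity) h2
  · have h1 := Gamma_add_div_le_rpow (z := p + n) (by linarith) ha
    have h2 := rpow_le_Gamma_add_div (z := p + n + A) (by linarith) ha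
    rw [show p + n + (A - 1) = p + n + A - 1 by ring]
    exact div_le_div₀ (rpow_nonneg (by linarith) _) h1 (rpow_pos_of_pos (by linarith) _) h2

theorem gammaQuot_le_succ (ha : 0 < a) (hA : 0 < A) {p : ℝ} (hp : 0 < p) :
    gammaQuot a A p ≤ gammaQuot a A (p + 1) := by
  rw [gammaQuot_rec ha hA hp]
  refine mul_le_of_le_one_right (gammaQuot_pos ha hA (by linarith)).le ?_
  have : 0 ≤ a * A / ((p + a) * (p + A)) := by positivity
  linarith

theorem gammaQuot_le_add_nat (ha : 0 < a) (hA : 0 < A) {p : ℝ} (hp : 0 < p) (n : ℕ) :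
    gammaQuot a A p ≤ gammaQuot a A (p + n) := by
  induction n with
  | zero => simp
  | succ n ih =>
    refine ih.trans ((gammaQuot_le_succ ha hA (by positivity)).trans_eq ?_)
    push_cast; ring_nf

theorem gammaQuot_le_one (ha : 0 < a) (hA : 0 < A) {p : ℝ} (hp : 1 < p) : gammaQuot a A p ≤ 1 :=
  ge_of_tendsto' (tendsto_gammaQuot ha hA hp) (gammaQuot_le_add_nat ha hA (by linarith))

/-- The function `p ↦ gammaQuot a A p + a * A / (p - 1)` decreases along `p, p + 1, …`, with
limit `1`. -/
theorem one_sub_le_gammaQuot (ha : 0 < a) (hA : 0 < A) {p : ℝ} (hp : 1 < p) :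
    1 - a * A / (p - 1) ≤ gammaQuot a A p := by
  have hanti : ∀ n : ℕ, gammaQuot a A (p + n) + a * A / (p + n - 1) ≤
      gammaQuot a A p + a * A / (p - 1) := by
    intro n
    induction n with
    | zero => simp
    | succ n ih =>
      refine le_trans ?_ ih
      have hn : (0 : ℝ) ≤ n := n.cast_nonneg
      set q := p + (n : ℝ) with hq
      have hq1 : 1 < q := by linarith
      have hq0 : 0 < q - 1 := by linarith
      rw [show p + ((n + 1 : ℕ) : ℝ) = q + 1 by rw [hq]; push_cast; ring,
        gammaQuot_rec ha hA (show 0 < q by linarith), add_sub_cancel_right]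
      have h1 := gammaQuot_le_one ha hA (show 1 < q + 1 by linarith)
      have h2 : gammaQuot a A (q + 1) * (a * A / ((q + a) * (q + A))) ≤ a * A / (q * q) := by
        have h3 : a * A / ((q + a) * (q + A)) ≤ a * A / (q * q) := by
          gcongr <;> linarith
        exact (mul_le_of_le_one_left (by positivity) h1).trans h3
      have h4 : a * A / (q * q) ≤ a * A / (q - 1) - a * A / q := by
        rw [div_sub_div _ _ hq0.ne' (by positivity), div_le_div_iff₀ (by positivity) (by positivity)]
        have : 0 < a * A := by positivity
        nlinarith [mul_pos this (show 0 < q by linarith)]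
      linarith
  have hlim : Tendsto (fun n : ℕ => gammaQuot a A (p + n) + a * A / (p + n - 1)) atTop
      (𝓝 (1 + 0)) := by
    refine (tendsto_gammaQuot ha hA hp).add (tendsto_const_nhds.div_atTop ?_)
    exact tendsto_atTop_add_const_right _ _
      (tendsto_atTop_add_const_left _ _ tendsto_natCast_atTop_atTop)
  have := le_of_tendsto' hlim hanti
  linarith

end

/-! ### Pascal's rule for the edge density -/

section
open Real
variable {a A : ℝ}

/-- Pascal arrays are nonnegative once they are nonnegative and nondecreasing on the two axes. -/
theorem pascal_nonneg {H : ℕ → ℕ → ℝ} (h00 : 0 ≤ H 0 0) (hx : ∀ x, H x 0 ≤ H (x + 1) 0)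
    (hy : ∀ y, H 0 y ≤ H 0 (y + 1))
    (hxy : ∀ x y, H (x + 1) (y + 1) = H x (y + 1) + H (x + 1) y) (x y : ℕ) : 0 ≤ H x y := by
  induction x generalizing y with
  | zero =>
    induction y with
    | zero => exact h00
    | succ y ih => exact ih.trans (hy y)
  | succ x ihx =>
    induction y with
    | zero => exact (ihx 0).trans (hx x)
    | succ y ih => rw [hxy]; exact add_nonneg (ihx _) ih

/-- The integrating factor that turns the recursion of the edge densities into Pascal's rule. -/
noncomputable def pascalFactor (a A : ℝ) (x y : ℕ) : ℝ :=
  A * (a + 1) * (Gamma (A + a + 1) / Gamma A) *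
    (Gamma (x + A) * Gamma (y + A) / Gamma (x + y + 2 * A + a + 2))

theorem pascalFactor_pos (ha : 0 < a) (hA : 0 < A) (x y : ℕ) : 0 < pascalFactor a A x y := by
  have := Gamma_pos_of_pos hA
  have := Gamma_pos_of_pos (show 0 < A + a + 1 by positivity)
  have := Gamma_pos_of_pos (show 0 < x + A by positivity)
  have := Gamma_pos_of_pos (show 0 < y + A by positivity)
  have := Gamma_pos_of_pos (show 0 < x + y + 2 * A + a + 2 by positivity)
  unfold pascalFactor; positivity

theorem pascalFactor_comm (x y : ℕ) : pascalFactor a A x y = pascalFactor a A y x := by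
  unfold pascalFactor
  rw [mul_comm (Gamma (x + A)), add_comm (x : ℝ) y]

theorem pascalFactor_succ (ha : 0 < a) (hA : 0 < A) (x y : ℕ) :
    (x + 1 + y + 2 * A + a + 1) * pascalFactor a A (x + 1) y = (x + A) * pascalFactor a A x y := by
  have h2 := Gamma_pos_of_pos (show 0 < x + y + 2 * A + a + 2 by positivity)
  unfold pascalFactor
  push_cast
  rw [show (x : ℝ) + 1 + A = x + A + 1 by ring, Gamma_add_one (s := x + A) (by positivity),
    show (x : ℝ) + 1 + y + 2 * A + a + 2 = x + y + 2 * A + a + 2 + 1 by ring,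
    Gamma_add_one (s := x + y + 2 * A + a + 2) (by positivity)]
  have : (x : ℝ) + y + 2 * A + a + 2 ≠ 0 := by positivity
  field_simp
  ring

theorem nodeDensity_eq (ha : 0 < a) (hA : 0 < A) (x : ℕ) :
    nodeDensity a A x =
      (a + 1) * Gamma (x + A) * Gamma (A + a + 1) / (Gamma A * Gamma (x + A + a + 2)) := by
  induction x with
  | zero =>
    have := Gamma_pos_of_pos hA
    have := Gamma_pos_of_pos (show 0 < A + a + 1 by positivity)
    simp only [nodeDensity, CharP.cast_eq_zero, zero_add]
    rw [show A + a + 2 = A + a + 1 + 1 by ring, Gamma_add_one (s := A + a + 1) (by positivity)]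
    field_simp
  | succ x ih =>
    have := Gamma_pos_of_pos hA
    have := Gamma_pos_of_pos (show 0 < x + A + a + 2 by positivity)
    simp only [nodeDensity, ih]
    push_cast
    rw [show (x : ℝ) + 1 + A = x + A + 1 by ring, Gamma_add_one (s := x + A) (by positivity),
      show (x : ℝ) + A + 1 + a + 2 = x + A + a + 2 + 1 by ring,
      Gamma_add_one (s := x + A + a + 2) (by positivity)]
    field_simp; ring

/-- The symmetrised edge density. -/
noncomputable def linkDensity (a A : ℝ) (x y : ℕ) : ℝ :=
  edgeDensity a A x y + edgeDensity a A y x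

theorem linkDensity_comm (x y : ℕ) : linkDensity a A x y = linkDensity a A y x := add_comm _ _

/-- The symmetrised edge density after division by its integrating factor. -/
noncomputable def pascalDensity (a A : ℝ) (x y : ℕ) : ℝ :=
  linkDensity a A x y / pascalFactor a A x y

theorem pascalDensity_comm (x y : ℕ) : pascalDensity a A x y = pascalDensity a A y x := by
  rw [pascalDensity, pascalDensity, linkDensity_comm, pascalFactor_comm]

theorem linkDensity_eq (ha : 0 < a) (hA : 0 < A) (x y : ℕ) :
    linkDensity a A x y = pascalFactor a A x y * pascalDensity a A x y := by
  rw [pascalDensity, mul_div_cancel₀ _ (pascalFactor_pos ha hA x y).ne']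

theorem linkDensity_rec (ha : 0 < a) (hA : 0 < A) (x y : ℕ) :
    (x + y + 2 * A + a + 1) * linkDensity a A x y =
      inflow A (fun i => linkDensity a A i y) x + inflow A (linkDensity a A x) y +
        ((if x = 0 then inflow A (nodeDensity a A) y else 0) +
          if y = 0 then inflow A (nodeDensity a A) x else 0) := by
  have h1 := edgeDensity_rec ha hA x y
  have h2 := edgeDensity_rec ha hA y x
  have e1 : inflow A (fun i => linkDensity a A i y) x =
      inflow A (fun i => edgeDensity a A i y) x + inflow A (edgeDensity a A y) x := by
    cases x <;> simp [inflow, linkDensity, mul_add]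
  have e2 : inflow A (linkDensity a A x) y =
      inflow A (edgeDensity a A x) y + inflow A (fun i => edgeDensity a A i x) y := by
    cases y <;> simp [inflow, linkDensity, mul_add]
  rw [e1, e2, linkDensity]
  linear_combination h1 + h2

theorem pascalDensity_zero_zero : pascalDensity a A 0 0 = 0 := by
  simp [pascalDensity, linkDensity, edgeDensity]

theorem pascalDensity_succ_zero (ha : 0 < a) (hA : 0 < A) (x : ℕ) :
    pascalDensity a A (x + 1) 0 = pascalDensity a A x 0 +
      Gamma (x + 2 * A + a + 2) / (Gamma (x + A + a + 2) * Gamma (A + 1)) := by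
  have hr := linkDensity_rec ha hA (x + 1) 0
  have hs := pascalFactor_succ ha hA x 0
  have hw := pascalFactor_pos ha hA (x + 1) 0
  simp only [inflow, linkDensity_eq ha hA] at hr
  have g1 := Gamma_pos_of_pos hA
  have g2 := Gamma_pos_of_pos (show 0 < A + a + 1 by positivity)
  have g3 := Gamma_pos_of_pos (show 0 < x + A by positivity)
  have g4 := Gamma_pos_of_pos (show 0 < x + 2 * A + a + 2 by positivity)
  have g5 := Gamma_pos_of_pos (show 0 < x + A + a + 2 by positivity)
  have hN : (x + A) * nodeDensity a A x = (x + A) * pascalFactor a A x 0 *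
      (Gamma (x + 2 * A + a + 2) / (Gamma (x + A + a + 2) * Gamma (A + 1))) := by
    rw [nodeDensity_eq ha hA, pascalFactor, Gamma_add_one hA.ne']
    simp only [CharP.cast_eq_zero, zero_add, add_zero]
    field_simp
  have hpos : (0 : ℝ) < x + 1 + (0 : ℕ) + 2 * A + a + 1 := by positivity
  apply mul_left_cancel₀ (mul_pos hpos hw).ne'
  simp only [Nat.add_eq_zero_iff, one_ne_zero, and_false, if_false, if_true, zero_add] at hr
  push_cast at hr hs ⊢
  rw [mul_add, hs, ← hN, ← hs]
  linear_combination hr - pascalDensity a A x 0 * hs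

theorem pascalDensity_succ_succ (ha : 0 < a) (hA : 0 < A) (x y : ℕ) :
    pascalDensity a A (x + 1) (y + 1) =
      pascalDensity a A x (y + 1) + pascalDensity a A (x + 1) y := by
  have hr := linkDensity_rec ha hA (x + 1) (y + 1)
  have hs := pascalFactor_succ ha hA x (y + 1)
  have hs' := pascalFactor_succ ha hA y (x + 1)
  rw [pascalFactor_comm, pascalFactor_comm y] at hs'
  have hw := pascalFactor_pos ha hA (x + 1) (y + 1)
  simp only [inflow, linkDensity_eq ha hA] at hr
  have hpos : (0 : ℝ) < x + 1 + (y + 1) + 2 * A + a + 1 := by positivity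
  apply mul_left_cancel₀ (mul_pos hpos hw).ne'
  simp only [Nat.add_eq_zero_iff, one_ne_zero, and_false, if_false, add_zero] at hr
  push_cast at hr hs hs' ⊢
  linear_combination hr - pascalDensity a A x (y + 1) * hs - pascalDensity a A (x + 1) y * hs'

/-- Generalised binomial coefficients: the leading term of `pascalDensity`. -/
noncomputable def pascalMain (A : ℝ) (x y : ℕ) : ℝ :=
  Gamma (x + y + 2 * A + 3) / (Gamma (x + A + 2) * Gamma (y + A + 2))

/-- Generalised binomial coefficients of lower order: the correction term of `pascalDensity`. -/
noncomputable def pascalCorr (A : ℝ) (x y : ℕ) : ℝ :=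
  Gamma (x + y + 2 * A + 1) / (Gamma (x + A + 1) * Gamma (y + A + 1))

theorem pascalMain_comm (x y : ℕ) : pascalMain A x y = pascalMain A y x := by
  unfold pascalMain; rw [mul_comm (Gamma _), add_comm (x : ℝ) y]

theorem pascalCorr_comm (x y : ℕ) : pascalCorr A x y = pascalCorr A y x := by
  unfold pascalCorr; rw [mul_comm (Gamma _), add_comm (x : ℝ) y]

/-- Pascal's rule for generalised binomial coefficients. -/
theorem Gamma_pascal {u v : ℝ} (hu : 0 < u) (hv : 0 < v) :
    Gamma (u + v + 1) / (Gamma (u + 1) * Gamma (v + 1)) =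
      Gamma (u + v) / (Gamma u * Gamma (v + 1)) + Gamma (u + v) / (Gamma (u + 1) * Gamma v) := by
  have := Gamma_pos_of_pos hu
  have := Gamma_pos_of_pos hv
  rw [Gamma_add_one hu.ne', Gamma_add_one hv.ne', Gamma_add_one (by positivity)]
  field_simp

theorem pascalMain_succ_succ (hA : 0 < A) (x y : ℕ) :
    pascalMain A (x + 1) (y + 1) = pascalMain A x (y + 1) + pascalMain A (x + 1) y := by
  have hx : (0 : ℝ) ≤ x := x.cast_nonneg
  have hy : (0 : ℝ) ≤ y := y.cast_nonneg
  have h := Gamma_pascal (u := x + A + 2) (v := y + A + 2) (by positivity) (by positivity)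
  unfold pascalMain
  push_cast
  convert h using 3 <;> ring_nf

theorem pascalCorr_succ_succ (hA : 0 < A) (x y : ℕ) :
    pascalCorr A (x + 1) (y + 1) = pascalCorr A x (y + 1) + pascalCorr A (x + 1) y := by
  have hx : (0 : ℝ) ≤ x := x.cast_nonneg
  have hy : (0 : ℝ) ≤ y := y.cast_nonneg
  have h := Gamma_pascal (u := x + A + 1) (v := y + A + 1) (by positivity) (by positivity)
  unfold pascalCorr
  push_cast
  convert h using 3 <;> ring_nf

theorem pascalMain_succ_zero (hA : 0 < A) (x : ℕ) :
    pascalMain A (x + 1) 0 = pascalMain A x 0 +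
      Gamma (x + 2 * A + 3) / (Gamma (x + A + 3) * Gamma (A + 1)) := by
  have hx : (0 : ℝ) ≤ x := x.cast_nonneg
  have h := Gamma_pascal (u := x + A + 2) (v := A + 1) (by positivity) (by positivity)
  unfold pascalMain
  push_cast
  convert h using 3 <;> ring_nf

theorem pascalCorr_succ_zero (hA : 0 < A) (x : ℕ) :
    pascalCorr A (x + 1) 0 = pascalCorr A x 0 +
      Gamma (x + 2 * A + 1) / (Gamma (x + A + 2) * Gamma A) := by
  have hx : (0 : ℝ) ≤ x := x.cast_nonneg
  have h1 := Gamma_pos_of_pos hA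
  have h2 := Gamma_pos_of_pos (show 0 < x + A + 1 by positivity)
  unfold pascalCorr
  push_cast
  simp only [add_zero, zero_add]
  rw [show (x : ℝ) + 1 + 2 * A + 1 = x + 2 * A + 1 + 1 by ring, Gamma_add_one (by positivity),
    show (x : ℝ) + 1 + A + 1 = x + A + 1 + 1 by ring, show (x : ℝ) + A + 2 = x + A + 1 + 1 by ring,
    Gamma_add_one (show (x : ℝ) + A + 1 ≠ 0 by positivity), Gamma_add_one hA.ne']
  field_simp
  ring

end

/-! ### Bounds for the correction term -/

section
open Real
variable {a A : ℝ}

/-- The upper bound for the coefficient of the correction term. -/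
noncomputable def corrUpper (a A : ℝ) : ℝ :=
  a * ((Gamma (A + 1) * Gamma (2 * A + a + 3)) / (Gamma (2 * A + 2) * Gamma (A + a + 2)))

theorem corrUpper_eq (ha : 0 < a) (hA : 0 < A) :
    corrUpper a A = a * ((2 * A + a + 2) / (A + 1)) / gammaQuot a A (A + 2) := by
  have h1 := Gamma_pos_of_pos (show 0 < A + 1 by positivity)
  have h2 := Gamma_pos_of_pos (show 0 < 2 * A + 2 by positivity)
  have h3 := Gamma_pos_of_pos (show 0 < A + a + 2 by positivity)
  have h4 := Gamma_pos_of_pos (show 0 < 2 * A + a + 2 by positivity)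
  unfold corrUpper gammaQuot
  rw [show 2 * A + a + 3 = 2 * A + a + 2 + 1 by ring,
    Gamma_add_one (s := 2 * A + a + 2) (by positivity), show A + 2 + a = A + a + 2 by ring,
    show A + 2 + A = 2 * A + 2 by ring, show 2 * A + 2 + a = 2 * A + a + 2 by ring,
    show A + 2 = A + 1 + 1 by ring, Gamma_add_one (s := A + 1) (by positivity)]
  field_simp

/-- The increments of `pascalDensity`, `pascalMain` and `pascalCorr` along the axis, in units of
the middle quantity `Γ(p + A) / (Γ(p) Γ(A + 1))`, where `p = x + A + 2`. -/
theorem axis_increments (ha : 0 < a) (hA : 0 < A) (x : ℕ) {p V : ℝ} (hp : p = x + A + 2)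
    (hV : V = Gamma (p + A) / (Gamma p * Gamma (A + 1))) :
    Gamma (x + 2 * A + a + 2) / (Gamma (x + A + a + 2) * Gamma (A + 1)) =
        V * (1 / gammaQuot a A p) ∧
      Gamma (x + 2 * A + 3) / (Gamma (x + A + 3) * Gamma (A + 1)) = V * ((p + A) / p) ∧
      Gamma (x + 2 * A + 1) / (Gamma (x + A + 2) * Gamma A) = V * (A / (p + A - 1)) := by
  have hx : (0 : ℝ) ≤ x := x.cast_nonneg
  have hp0 : 0 < p := by rw [hp]; positivity
  have hq0 : 0 < p + A - 1 := by rw [hp]; linarith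
  have g1 := Gamma_pos_of_pos hA
  have g2 := Gamma_pos_of_pos hp0
  have g3 := Gamma_pos_of_pos hq0
  have g4 := Gamma_pos_of_pos (show 0 < p + a by positivity)
  have g5 := Gamma_pos_of_pos (show 0 < p + A + a by positivity)
  have g6 := Gamma_pos_of_pos (show 0 < p + A by positivity)
  have hgA : Gamma (A + 1) = A * Gamma A := Gamma_add_one hA.ne'
  refine ⟨?_, ?_, ?_⟩
  · rw [show (x : ℝ) + 2 * A + a + 2 = p + A + a by rw [hp]; ring,
      show (x : ℝ) + A + a + 2 = p + a by rw [hp]; ring, hV, gammaQuot, hgA]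
    field_simp
  · rw [show (x : ℝ) + 2 * A + 3 = p + A + 1 by rw [hp]; ring,
      show (x : ℝ) + A + 3 = p + 1 by rw [hp]; ring, hV, hgA, Gamma_add_one hp0.ne',
      Gamma_add_one (s := p + A) (by positivity)]
    field_simp
  · rw [show (x : ℝ) + 2 * A + 1 = p + A - 1 by rw [hp]; ring, ← hp, hV, hgA,
      show p + A = p + A - 1 + 1 by ring, Gamma_add_one hq0.ne', add_sub_cancel_right]
    field_simp

theorem axis_increment_lower (ha : 0 < a) (hA : 0 < A) (x : ℕ) :
    Gamma (x + 2 * A + 3) / (Gamma (x + A + 3) * Gamma (A + 1)) +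
        (-4 + 2 / (1 + A)) * (Gamma (x + 2 * A + 1) / (Gamma (x + A + 2) * Gamma A)) ≤
      Gamma (x + 2 * A + a + 2) / (Gamma (x + A + a + 2) * Gamma (A + 1)) := by
  obtain ⟨p, hp⟩ : ∃ p : ℝ, p = x + A + 2 := ⟨_, rfl⟩
  obtain ⟨h1, h2, h3⟩ := axis_increments ha hA x hp rfl
  have hx : (0 : ℝ) ≤ x := x.cast_nonneg
  have hp1 : 1 < p := by linarith
  have hq0 : 0 < p + A - 1 := by linarith
  have hV : 0 < Gamma (p + A) / (Gamma p * Gamma (A + 1)) := by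
    have g1 := Gamma_pos_of_pos (show 0 < A + 1 by positivity)
    have g2 := Gamma_pos_of_pos (show 0 < p by linarith)
    have g3 := Gamma_pos_of_pos (show 0 < p + A by linarith)
    positivity
  rw [h1, h2, h3]
  have hΦ : 1 ≤ 1 / gammaQuot a A p := by
    rw [le_div_iff₀ (gammaQuot_pos ha hA (by linarith)), one_mul]
    exact gammaQuot_le_one ha hA hp1
  have hκ : -4 + 2 / (1 + A) ≤ -2 := by
    have : 2 / (1 + A) ≤ 2 := by rw [div_le_iff₀ (by positivity)]; linarith
    linarith
  have h4 : (p + A) / p + (-4 + 2 / (1 + A)) * (A / (p + A - 1)) ≤ 1 := by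
    have h5 : (-4 + 2 / (1 + A)) * (A / (p + A - 1)) ≤ -2 * (A / (p + A - 1)) := by gcongr
    have h6 : A / p ≤ 2 * (A / (p + A - 1)) := by
      rw [mul_div_assoc', div_le_div_iff₀ (by linarith) hq0]
      nlinarith
    rw [add_div, div_self (by linarith)]
    linarith
  calc _ = Gamma (p + A) / (Gamma p * Gamma (A + 1)) *
        ((p + A) / p + (-4 + 2 / (1 + A)) * (A / (p + A - 1))) := by ring
    _ ≤ _ := by gcongr; exact h4.trans hΦ

theorem axis_increment_upper (ha : 0 < a) (hA : 0 < A) (x : ℕ) :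
    Gamma (x + 2 * A + a + 2) / (Gamma (x + A + a + 2) * Gamma (A + 1)) ≤
      Gamma (x + 2 * A + 3) / (Gamma (x + A + 3) * Gamma (A + 1)) +
        corrUpper a A * (Gamma (x + 2 * A + 1) / (Gamma (x + A + 2) * Gamma A)) := by
  obtain ⟨p, hp⟩ : ∃ p : ℝ, p = x + A + 2 := ⟨_, rfl⟩
  obtain ⟨h1, h2, h3⟩ := axis_increments ha hA x hp rfl
  have hx : (0 : ℝ) ≤ x := x.cast_nonneg
  have hp1 : 1 < p := by linarith
  have hp0 : 0 < p - 1 := by linarith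
  have hq0 : 0 < p + A - 1 := by linarith
  have hV : 0 < Gamma (p + A) / (Gamma p * Gamma (A + 1)) := by
    have g1 := Gamma_pos_of_pos (show 0 < A + 1 by positivity)
    have g2 := Gamma_pos_of_pos (show 0 < p by linarith)
    have g3 := Gamma_pos_of_pos (show 0 < p + A by linarith)
    positivity
  rw [h1, h2, h3, corrUpper_eq ha hA]
  have hΦ := gammaQuot_pos ha hA (show 0 < p by linarith)
  have hΦ₀ := gammaQuot_pos ha hA (show 0 < A + 2 by linarith)
  have hmono : 1 / gammaQuot a A p ≤ 1 / gammaQuot a A (A + 2) := by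
    gcongr
    have := gammaQuot_le_add_nat ha hA (show 0 < A + 2 by linarith) x
    rwa [show A + 2 + x = p by rw [hp]; ring] at this
  have h4 : 1 / gammaQuot a A p ≤ 1 + 1 / gammaQuot a A p * (a * A / (p - 1)) := by
    have := one_sub_le_gammaQuot ha hA hp1
    rw [div_le_iff₀ hΦ, add_mul, mul_right_comm, one_div_mul_cancel hΦ.ne']
    linarith
  have h5 : a * A / (p - 1) ≤ a * ((2 * A + a + 2) / (A + 1)) * (A / (p + A - 1)) := by
    have h6 : 2 ≤ (2 * A + a + 2) / (A + 1) := by rw [le_div_iff₀ (by positivity)]; linarith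
    calc a * A / (p - 1) ≤ a * 2 * (A / (p + A - 1)) := by
          rw [mul_div_assoc', div_le_div_iff₀ hp0 hq0]
          nlinarith [mul_pos ha hA]
      _ ≤ _ := by gcongr
  have h7 : 1 / gammaQuot a A p ≤ (p + A) / p +
      a * ((2 * A + a + 2) / (A + 1)) / gammaQuot a A (A + 2) * (A / (p + A - 1)) := by
    have h8 : 1 ≤ (p + A) / p := by rw [le_div_iff₀ (by linarith)]; linarith
    have h9 : 1 / gammaQuot a A p * (a * A / (p - 1)) ≤ 1 / gammaQuot a A (A + 2) *
        (a * ((2 * A + a + 2) / (A + 1)) * (A / (p + A - 1))) := by gcongr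
    have h10 : 1 / gammaQuot a A (A + 2) * (a * ((2 * A + a + 2) / (A + 1)) * (A / (p + A - 1))) =
      a * ((2 * A + a + 2) / (A + 1)) / gammaQuot a A (A + 2) * (A / (p + A - 1)) := by ring
    linarith
  calc _ ≤ Gamma (p + A) / (Gamma p * Gamma (A + 1)) * ((p + A) / p +
      a * ((2 * A + a + 2) / (A + 1)) / gammaQuot a A (A + 2) * (A / (p + A - 1))) := by gcongr
    _ = _ := by ring

theorem pascalMain_pos (hA : 0 < A) (x y : ℕ) : 0 < pascalMain A x y := by
  have := Gamma_pos_of_pos (show 0 < x + y + 2 * A + 3 by positivity)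
  have := Gamma_pos_of_pos (show 0 < x + A + 2 by positivity)
  have := Gamma_pos_of_pos (show 0 < y + A + 2 by positivity)
  unfold pascalMain; positivity

theorem pascalCorr_pos (hA : 0 < A) (x y : ℕ) : 0 < pascalCorr A x y := by
  have := Gamma_pos_of_pos (show 0 < x + y + 2 * A + 1 by positivity)
  have := Gamma_pos_of_pos (show 0 < x + A + 1 by positivity)
  have := Gamma_pos_of_pos (show 0 < y + A + 1 by positivity)
  unfold pascalCorr; positivity

theorem pascalCorr_eq (hA : 0 < A) (x y : ℕ) :
    pascalCorr A x y = pascalMain A x y * (((x + A + 1) * (y + A + 1)) /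
      ((x + y + 2 * A + 1) * (x + y + 2 * A + 2))) := by
  have := Gamma_pos_of_pos (show 0 < x + y + 2 * A + 1 by positivity)
  have := Gamma_pos_of_pos (show 0 < x + A + 1 by positivity)
  have := Gamma_pos_of_pos (show 0 < y + A + 1 by positivity)
  unfold pascalCorr pascalMain
  rw [show (x : ℝ) + A + 2 = x + A + 1 + 1 by ring, show (y : ℝ) + A + 2 = y + A + 1 + 1 by ring,
    show (x : ℝ) + y + 2 * A + 3 = x + y + 2 * A + 1 + 1 + 1 by ring,
    show (x : ℝ) + y + 2 * A + 2 = x + y + 2 * A + 1 + 1 by ring,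
    Gamma_add_one (s := x + A + 1) (by positivity), Gamma_add_one (s := y + A + 1) (by positivity),
    Gamma_add_one (s := x + y + 2 * A + 1 + 1) (by positivity),
    Gamma_add_one (s := x + y + 2 * A + 1) (by positivity)]
  field_simp

theorem le_pascalDensity (ha : 0 < a) (hA : 0 < A) (x y : ℕ) :
    pascalMain A x y + (-4 + 2 / (1 + A)) * pascalCorr A x y ≤ pascalDensity a A x y := by
  set H : ℕ → ℕ → ℝ := fun x y => pascalDensity a A x y -
    (pascalMain A x y + (-4 + 2 / (1 + A)) * pascalCorr A x y) with hH
  have hcomm : ∀ x y, H x y = H y x := fun x y => by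
    simp only [hH]; rw [pascalDensity_comm, pascalMain_comm, pascalCorr_comm]
  have hx : ∀ x, H x 0 ≤ H (x + 1) 0 := fun x => by
    simp only [hH]
    rw [pascalDensity_succ_zero ha hA, pascalMain_succ_zero hA, pascalCorr_succ_zero hA]
    have := axis_increment_lower ha hA x
    linarith
  have h := pascal_nonneg (H := H) (by
      -- the lower bound is attained at the origin
      have hm := pascalMain_pos hA 0 0
      simp only [hH, pascalDensity_zero_zero, pascalCorr_eq hA 0 0]
      refine le_of_eq ?_
      push_cast
      field_simp
      ring) hx
    (fun y => by rw [hcomm 0 y, hcomm 0 (y + 1)]; exact hx y) (fun x y => by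
      simp only [hH]
      rw [pascalDensity_succ_succ ha hA, pascalMain_succ_succ hA, pascalCorr_succ_succ hA]
      ring) x y
  simp only [hH] at h
  linarith

theorem pascalDensity_le (ha : 0 < a) (hA : 0 < A) (x y : ℕ) :
    pascalDensity a A x y ≤ pascalMain A x y + corrUpper a A * pascalCorr A x y := by
  set H : ℕ → ℕ → ℝ := fun x y => pascalMain A x y + corrUpper a A * pascalCorr A x y -
    pascalDensity a A x y with hH
  have hcomm : ∀ x y, H x y = H y x := fun x y => by
    simp only [hH]; rw [pascalDensity_comm, pascalMain_comm, pascalCorr_comm]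
  have hx : ∀ x, H x 0 ≤ H (x + 1) 0 := fun x => by
    simp only [hH]
    rw [pascalDensity_succ_zero ha hA, pascalMain_succ_zero hA, pascalCorr_succ_zero hA]
    have := axis_increment_upper ha hA x
    linarith
  have hU : 0 ≤ corrUpper a A := by
    rw [corrUpper_eq ha hA]
    have := gammaQuot_pos ha hA (show 0 < A + 2 by linarith)
    positivity
  have h := pascal_nonneg (H := H) (by
      have hm := pascalMain_pos hA 0 0
      have hc := pascalCorr_pos hA 0 0
      simp only [hH, pascalDensity_zero_zero, sub_zero]
      exact add_nonneg hm.le (mul_nonneg hU hc.le)) hx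
    (fun y => by rw [hcomm 0 y, hcomm 0 (y + 1)]; exact hx y) (fun x y => by
      simp only [hH]
      rw [pascalDensity_succ_succ ha hA, pascalMain_succ_succ hA, pascalCorr_succ_succ hA]
      ring) x y
  simp only [hH] at h
  linarith

/-- The leading term of the density of edges between excesses `x` and `y`. -/
noncomputable def linkMain (a A : ℝ) (x y : ℝ) : ℝ :=
  Gamma (x + A) * Gamma (y + A) * Gamma (x + y + 2 * A + 3) /
    (Gamma (x + A + 2) * Gamma (y + A + 2) * Gamma (x + y + 2 * A + a + 2))

theorem exists_linkDensity_eq (ha : 0 < a) (hA : 0 < A) (x y : ℕ) :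
    ∃ θ : ℝ, linkDensity a A x y =
        linkMain a A x y * (A * (a + 1) * (Gamma (A + a + 1) / Gamma A)) *
          (1 + θ * (((x + A + 1) * (y + A + 1)) /
            ((x + y + 2 * A + 1) * (x + y + 2 * A + 2)))) ∧
      -4 + 2 / (1 + A) ≤ θ ∧ θ ≤ corrUpper a A := by
  have hc := pascalCorr_pos hA x y
  refine ⟨(pascalDensity a A x y - pascalMain A x y) / pascalCorr A x y, ?_, ?_, ?_⟩
  · set θ := (pascalDensity a A x y - pascalMain A x y) / pascalCorr A x y with hθ
    have h1 : pascalDensity a A x y = pascalMain A x y + θ * pascalCorr A x y := by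
      rw [hθ, div_mul_cancel₀ _ hc.ne']; ring
    rw [linkDensity_eq ha hA, h1, pascalCorr_eq hA, linkMain, pascalFactor, pascalMain]
    ring
  · rw [le_div_iff₀ hc]; linarith [le_pascalDensity ha hA x y]
  · rw [div_le_iff₀ hc]; linarith [pascalDensity_le ha hA x y]

end

/-! ### The power law -/

section
open Real Filter Asymptotics

/-- Products of factors `1 + O(δ)` with bounded `δ` are `1 + O(δ)`. -/
theorem isBigO_mul_sub_one {α : Type*} {l : Filter α} {f g δ : α → ℝ}
    (hδ : δ =O[l] fun _ => (1 : ℝ)) (hf : (fun i => f i - 1) =O[l] δ)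
    (hg : (fun i => g i - 1) =O[l] δ) : (fun i => f i * g i - 1) =O[l] δ := by
  have h := (hf.mul (hg.trans hδ)).add ((hf.add hg).congr_right fun i => (mul_one (δ i)).symm)
  simp only [mul_one] at h
  exact h.congr_left fun i => by ring

/-- The weight of a node of degree `d` is comparable to `d`. -/
theorem min_mul_le {a k d : ℝ} (hk : 0 ≤ k) (hd : k ≤ d) : min 1 a * d ≤ d - k + k * a := by
  rcases le_total 1 a with h | h
  · rw [min_eq_left h]; nlinarith
  · rw [min_eq_right h]; nlinarith

theorem abs_div_sub_one_le {d m c e : ℝ} (hd : 0 < d) (hm : 0 < m) (hc : m * d ≤ d + c)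
    (he : |c| ≤ e) : |d / (d + c) - 1| ≤ e / m * (1 / d) := by
  have hpos : 0 < d + c := lt_of_lt_of_le (by positivity) hc
  rw [div_sub_one hpos.ne', sub_add_cancel_left, abs_div, abs_neg, abs_of_pos hpos,
    div_mul_div_comm, mul_one]
  exact div_le_div₀ ((abs_nonneg _).trans he) he (by positivity) hc

/-- `Γ(z) / Γ(z + a)` is `D ^ (-a) (1 + O(1 / D))` for `z = D + O(1)`. -/
theorem abs_Gamma_ratio_sub_one_le {a m e D z : ℝ} (ha : 0 < a) (hm : 0 < m) (hD : 0 < D)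
    (hz : m * D ≤ z - 1) (h1 : |z - 1 - D| ≤ e) (h2 : |z + a - D| ≤ e) :
    |D ^ a * (Gamma z / Gamma (z + a)) - 1| ≤
      a * (e + (1 / m) ^ a * (e / m)) * (1 / D) := by
  have hz1 : 0 < z - 1 := lt_of_lt_of_le (by positivity) hz
  have hza : 0 < z + a := by linarith
  have he : 0 ≤ e := (abs_nonneg _).trans h1
  have g1 := Gamma_pos_of_pos (show 0 < z by linarith)
  have g2 := Gamma_pos_of_pos hza
  have hlow := rpow_le_Gamma_add_div (show 1 < z by linarith) ha
  have hup := Gamma_add_div_le_rpow (show 0 < z by linarith) ha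
  have hinv : Gamma z / Gamma (z + a) = (Gamma (z + a) / Gamma z)⁻¹ := by rw [inv_div]
  have hgp : 0 < Gamma (z + a) / Gamma z := by positivity
  rw [hinv, ← div_eq_mul_inv]
  set G := Gamma (z + a) / Gamma z
  have hpowD : 0 < D ^ a := rpow_pos_of_pos hD a
  have hC : 0 ≤ a * ((1 / m) ^ a * (e / m)) * (1 / D) := by positivity
  have hC' : 0 ≤ a * e * (1 / D) := by positivity
  rw [abs_le]
  constructor
  · -- `t ^ a ≥ 1 + a * log t ≥ 1 + a * (1 - 1 / t)` at `t = D / (z + a)`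
    have h3 : (D / (z + a)) ^ a ≤ D ^ a / G := by
      rw [div_rpow hD.le hza.le]; gcongr
    have h4 : 1 + a * log (D / (z + a)) ≤ (D / (z + a)) ^ a := by
      rw [rpow_def_of_pos (by positivity)]
      have := add_one_le_exp (log (D / (z + a)) * a)
      linarith
    have h5 : 1 - (D / (z + a))⁻¹ ≤ log (D / (z + a)) := one_sub_inv_le_log_of_pos (by positivity)
    have h6 : (D / (z + a))⁻¹ - 1 ≤ e * (1 / D) := by
      rw [inv_div, div_sub_one hD.ne', mul_one_div]
      gcongr
      exact (le_abs_self _).trans h2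
    have h7 : -(e * (1 / D)) ≤ log (D / (z + a)) := by linarith
    have h8 := mul_le_mul_of_nonneg_left h7 ha.le
    linarith
  · -- `t ^ a ≤ 1 + a * log t * t ^ a ≤ 1 + a * (t - 1) * t ^ a` at `t = D / (z - 1)`
    have h3 : D ^ a / G ≤ (D / (z - 1)) ^ a := by
      rw [div_rpow hD.le hz1.le]
      exact div_le_div_of_nonneg_left hpowD.le (rpow_pos_of_pos hz1 a) hlow
    set t := D / (z - 1) with ht
    have htpos : 0 < t := by positivity
    have h4 : t ^ a - 1 ≤ a * log t * t ^ a := by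
      have h := add_one_le_exp (-(log t * a))
      have hp : 0 < t ^ a := rpow_pos_of_pos htpos a
      have hone : exp (-(log t * a)) * t ^ a = 1 := by
        rw [rpow_def_of_pos htpos, ← exp_add]; simp
      nlinarith [mul_le_mul_of_nonneg_right h hp.le]
    have h5 : log t ≤ e / m * (1 / D) := by
      refine (log_le_sub_one_of_pos htpos).trans ((le_abs_self _).trans ?_)
      have := abs_div_sub_one_le (c := z - 1 - D) hD hm (by linarith) h1
      rwa [add_sub_cancel] at this
    have h6 : t ^ a ≤ (1 / m) ^ a := by
      refine rpow_le_rpow htpos.le ?_ ha.le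
      rw [ht, div_le_div_iff₀ hz1 hm]; linarith
    have h7 : a * log t * t ^ a ≤ a * (e / m * (1 / D)) * (1 / m) ^ a := by
      have : 0 ≤ e / m * (1 / D) := by positivity
      have hp : 0 ≤ t ^ a := (rpow_pos_of_pos htpos a).le
      calc a * log t * t ^ a ≤ a * (e / m * (1 / D)) * t ^ a := by gcongr
        _ ≤ _ := by gcongr
    have h8 : a * (e / m * (1 / D)) * (1 / m) ^ a = a * ((1 / m) ^ a * (e / m)) * (1 / D) := by ring
    have h9 : a * (e + (1 / m) ^ a * (e / m)) * (1 / D) =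
      a * e * (1 / D) + a * ((1 / m) ^ a * (e / m)) * (1 / D) := by ring
    linarith

/-- The pairs of degrees that occur. -/
def degreePairs (k : ℕ) : Set (ℕ × ℕ) := {d | k ≤ d.1 ∧ k ≤ d.2}

/-- The relative error of the asymptotic formula for the edge density. -/
noncomputable def relError (d : ℕ × ℕ) : ℝ :=
  1 / (d.1 : ℝ) + 1 / (d.2 : ℝ) + (d.1 * d.2 : ℝ) / ((d.1 : ℝ) + d.2) ^ 2

theorem relError_nonneg (d : ℕ × ℕ) : 0 ≤ relError d := by unfold relError; positivity

variable {a : ℝ} {k : ℕ}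

theorem isBigO_relError_iff {f : ℕ × ℕ → ℝ} :
    f =O[𝓟 (degreePairs k)] relError ↔ ∃ C, ∀ d ∈ degreePairs k, |f d| ≤ C * relError d := by
  rw [isBigO_principal]
  simp only [norm_eq_abs, abs_of_nonneg (relError_nonneg _)]

theorem relError_isBigO_one (hk : 1 ≤ k) : relError =O[𝓟 (degreePairs k)] fun _ => (1 : ℝ) := by
  rw [isBigO_principal]
  refine ⟨3, fun d hd => ?_⟩
  have h1 : (1 : ℝ) ≤ d.1 := by exact_mod_cast hk.trans hd.1
  have h2 : (1 : ℝ) ≤ d.2 := by exact_mod_cast hk.trans hd.2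
  rw [norm_of_nonneg (relError_nonneg d), norm_one, mul_one]
  have e1 : 1 / (d.1 : ℝ) ≤ 1 := by rw [div_le_one (by linarith)]; exact h1
  have e2 : 1 / (d.2 : ℝ) ≤ 1 := by rw [div_le_one (by linarith)]; exact h2
  have e3 : (d.1 * d.2 : ℝ) / ((d.1 : ℝ) + d.2) ^ 2 ≤ 1 := by
    rw [div_le_one (by positivity)]; nlinarith
  unfold relError; linarith

theorem isBigO_of_inv_fst {f : ℕ × ℕ → ℝ} {C : ℝ} (hC : 0 ≤ C)
    (h : ∀ d ∈ degreePairs k, |f d| ≤ C * (1 / (d.1 : ℝ))) : f =O[𝓟 (degreePairs k)] relError := by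
  refine isBigO_relError_iff.mpr ⟨C, fun d hd => (h d hd).trans ?_⟩
  gcongr
  unfold relError
  have : 0 ≤ 1 / (d.2 : ℝ) + (d.1 * d.2 : ℝ) / ((d.1 : ℝ) + d.2) ^ 2 := by positivity
  linarith

theorem isBigO_of_inv_snd {f : ℕ × ℕ → ℝ} {C : ℝ} (hC : 0 ≤ C)
    (h : ∀ d ∈ degreePairs k, |f d| ≤ C * (1 / (d.2 : ℝ))) : f =O[𝓟 (degreePairs k)] relError := by
  refine isBigO_relError_iff.mpr ⟨C, fun d hd => (h d hd).trans ?_⟩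
  gcongr
  unfold relError
  have : 0 ≤ 1 / (d.1 : ℝ) + (d.1 * d.2 : ℝ) / ((d.1 : ℝ) + d.2) ^ 2 := by positivity
  linarith

theorem isBigO_of_inv_add (hk : 1 ≤ k) {f : ℕ × ℕ → ℝ} {C : ℝ} (hC : 0 ≤ C)
    (h : ∀ d ∈ degreePairs k, |f d| ≤ C * (1 / ((d.1 : ℝ) + d.2))) :
    f =O[𝓟 (degreePairs k)] relError := by
  refine isBigO_of_inv_fst hC fun d hd => (h d hd).trans ?_
  have h1 : (1 : ℝ) ≤ d.1 := by exact_mod_cast hk.trans hd.1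
  gcongr
  linarith [(d.2.cast_nonneg : (0 : ℝ) ≤ d.2)]

theorem isBigO_fst_div (ha : 0 < a) (hk : 1 ≤ k) {c : ℝ} (hc : 0 ≤ c) :
    (fun d : ℕ × ℕ => (d.1 : ℝ) / (d.1 + (-k + k * a + c)) - 1) =O[𝓟 (degreePairs k)] relError := by
  have hk0 : (0 : ℝ) ≤ k := k.cast_nonneg
  have hm : 0 < min 1 a := lt_min one_pos ha
  refine isBigO_of_inv_fst (C := (k + k * a + c) / min 1 a) (by positivity) fun d hd => ?_
  have h1 : (k : ℝ) ≤ d.1 := by exact_mod_cast hd.1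
  have h2 : (1 : ℝ) ≤ d.1 := by exact_mod_cast hk.trans hd.1
  have h3 := min_mul_le (a := a) hk0 h1
  have : 0 ≤ k * a := by positivity
  exact abs_div_sub_one_le (by linarith) hm (by linarith) (abs_le.mpr ⟨by linarith, by linarith⟩)

theorem isBigO_snd_div (ha : 0 < a) (hk : 1 ≤ k) {c : ℝ} (hc : 0 ≤ c) :
    (fun d : ℕ × ℕ => (d.2 : ℝ) / (d.2 + (-k + k * a + c)) - 1) =O[𝓟 (degreePairs k)] relError := by
  have hk0 : (0 : ℝ) ≤ k := k.cast_nonneg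
  have hm : 0 < min 1 a := lt_min one_pos ha
  refine isBigO_of_inv_snd (C := (k + k * a + c) / min 1 a) (by positivity) fun d hd => ?_
  have h1 : (k : ℝ) ≤ d.2 := by exact_mod_cast hd.2
  have h2 : (1 : ℝ) ≤ d.2 := by exact_mod_cast hk.trans hd.2
  have h3 := min_mul_le (a := a) hk0 h1
  have : 0 ≤ k * a := by positivity
  exact abs_div_sub_one_le (by linarith) hm (by linarith) (abs_le.mpr ⟨by linarith, by linarith⟩)

/-- The leading term of the edge density, relative to `(d₁ + d₂) ^ (1 - a) / (d₁ ^ 2 * d₂ ^ 2)`. -/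
theorem isBigO_linkMain (ha : 0 < a) (hk : 1 ≤ k) :
    (fun d : ℕ × ℕ => linkMain a (k * a) (d.1 - k) (d.2 - k) *
      (((d.1 : ℝ) ^ 2 * (d.2 : ℝ) ^ 2) / ((d.1 : ℝ) + d.2) ^ (1 - a)) - 1)
      =O[𝓟 (degreePairs k)] relError := by
  have hk1 : (1 : ℝ) ≤ k := by exact_mod_cast hk
  have hka : 0 < k * a := by positivity
  have hδ := relError_isBigO_one hk
  have hm : 0 < min 1 a := lt_min one_pos ha
  set z : ℕ × ℕ → ℝ := fun d => d.1 + d.2 - 2 * k + 2 * (k * a) + 2 with hz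
  have hlin : (fun d : ℕ × ℕ => z d / (d.1 + d.2) - 1) =O[𝓟 (degreePairs k)] relError := by
    refine isBigO_of_inv_add hk (C := 2 * k + 2 * (k * a) + 2) (by positivity) fun d hd => ?_
    have h2 : (1 : ℝ) ≤ d.1 := by exact_mod_cast hk.trans hd.1
    have h3 : (0 : ℝ) ≤ d.2 := d.2.cast_nonneg
    have hD : (0 : ℝ) < d.1 + d.2 := by linarith
    rw [div_sub_one hD.ne', abs_div, abs_of_pos hD, mul_one_div]
    gcongr
    rw [abs_le]; constructor <;> simp only [hz] <;> linarith
  have hgam : (fun d : ℕ × ℕ => ((d.1 : ℝ) + d.2) ^ a * (Gamma (z d) / Gamma (z d + a)) - 1)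
      =O[𝓟 (degreePairs k)] relError := by
    set e := 2 * k + 2 * (k * a) + 2 + a with he
    refine isBigO_of_inv_add hk
      (C := a * (e + (1 / min 1 a) ^ a * (e / min 1 a))) (by positivity) fun d hd => ?_
    have h1 : (k : ℝ) ≤ d.1 := by exact_mod_cast hd.1
    have h2 : (k : ℝ) ≤ d.2 := by exact_mod_cast hd.2
    have h3 := min_mul_le (a := a) (by positivity) h1
    have h4 := min_mul_le (a := a) (by positivity) h2
    have hD : (0 : ℝ) < d.1 + d.2 := by linarith
    refine abs_Gamma_ratio_sub_one_le ha hm hD ?_ ?_ ?_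
    · simp only [hz]; linarith
    · rw [abs_le]; constructor <;> simp only [hz, he] <;> linarith
    · rw [abs_le]; constructor <;> simp only [hz, he] <;> linarith
  have hfst := isBigO_mul_sub_one hδ (isBigO_fst_div ha hk le_rfl) (isBigO_fst_div ha hk zero_le_one)
  have hsnd := isBigO_mul_sub_one hδ (isBigO_snd_div ha hk le_rfl) (isBigO_snd_div ha hk zero_le_one)
  have hall := isBigO_mul_sub_one hδ (isBigO_mul_sub_one hδ hfst hsnd)
    (isBigO_mul_sub_one hδ hlin hgam)
  refine hall.congr' ?_ EventuallyEq.rfl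
  refine eventually_principal.mpr fun d hd => ?_
  have h1 : (k : ℝ) ≤ d.1 := by exact_mod_cast hd.1
  have h2 : (k : ℝ) ≤ d.2 := by exact_mod_cast hd.2
  have hD : (0 : ℝ) < d.1 + d.2 := by linarith
  have hu : 0 < (d.1 : ℝ) - k + k * a := by linarith
  have hv : 0 < (d.2 : ℝ) - k + k * a := by linarith
  have hz0 : 0 < z d := by simp only [hz]; linarith
  have g1 := Gamma_pos_of_pos hu
  have g2 := Gamma_pos_of_pos hv
  have g3 := Gamma_pos_of_pos hz0
  have g4 := Gamma_pos_of_pos (add_pos hz0 ha)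
  have hpow : ((d.1 : ℝ) + d.2) ^ (1 - a) = ((d.1 : ℝ) + d.2) / ((d.1 : ℝ) + d.2) ^ a := by
    rw [rpow_sub hD, rpow_one]
  have hpD : 0 < ((d.1 : ℝ) + d.2) ^ a := rpow_pos_of_pos hD a
  beta_reduce
  rw [hpow, linkMain]
  rw [show (d.1 : ℝ) - k + k * a + 2 = d.1 - k + k * a + 1 + 1 by ring,
    show (d.2 : ℝ) - k + k * a + 2 = d.2 - k + k * a + 1 + 1 by ring,
    show (d.1 : ℝ) - k + (d.2 - k) + 2 * (k * a) + 3 = z d + 1 by simp only [hz]; ring,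
    show (d.1 : ℝ) - k + (d.2 - k) + 2 * (k * a) + a + 2 = z d + a by simp only [hz]; ring,
    Gamma_add_one (s := z d) hz0.ne',
    Gamma_add_one (s := (d.1 : ℝ) - k + k * a + 1) (by linarith),
    Gamma_add_one (s := (d.1 : ℝ) - k + k * a) hu.ne',
    Gamma_add_one (s := (d.2 : ℝ) - k + k * a + 1) (by linarith),
    Gamma_add_one (s := (d.2 : ℝ) - k + k * a) hv.ne',
    show (d.1 : ℝ) + (-k + k * a + 0) = d.1 - k + k * a by ring,
    show (d.1 : ℝ) + (-k + k * a + 1) = d.1 - k + k * a + 1 by ring,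
    show (d.2 : ℝ) + (-k + k * a + 0) = d.2 - k + k * a by ring,
    show (d.2 : ℝ) + (-k + k * a + 1) = d.2 - k + k * a + 1 by ring]
  have hu1 : (d.1 : ℝ) - k + k * a + 1 ≠ 0 := by positivity
  have hv1 : (d.2 : ℝ) - k + k * a + 1 ≠ 0 := by positivity
  field_simp

/-- The correction term of the edge density is of relative order `d₁ d₂ / (d₁ + d₂) ^ 2`. -/
theorem isBigO_correction (ha : 0 < a) (hk : 1 ≤ k) {θ : ℕ × ℕ → ℝ} {B : ℝ}
    (hθ : ∀ d, |θ d| ≤ B) :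
    (fun d : ℕ × ℕ => (1 + θ d * (((d.1 - k + k * a + 1) * (d.2 - k + k * a + 1)) /
      ((d.1 - k + (d.2 - k) + 2 * (k * a) + 1) * (d.1 - k + (d.2 - k) + 2 * (k * a) + 2)))) - 1)
      =O[𝓟 (degreePairs k)] relError := by
  have hk1 : (1 : ℝ) ≤ k := by exact_mod_cast hk
  have hka : 0 < k * a := by positivity
  have hm : 0 < min 1 a := lt_min one_pos ha
  have hB : 0 ≤ B := (abs_nonneg _).trans (hθ 0)
  set m := min 1 a with hmdef
  set q := k * a + 2 with hq
  refine isBigO_relError_iff.mpr ⟨B * (q ^ 2 / m ^ 2), fun d hd => ?_⟩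
  have h1 : (k : ℝ) ≤ d.1 := by exact_mod_cast hd.1
  have h2 : (k : ℝ) ≤ d.2 := by exact_mod_cast hd.2
  have h3 := min_mul_le (a := a) (by positivity) h1
  have h4 := min_mul_le (a := a) (by positivity) h2
  rw [← hmdef] at h3 h4
  have hD : (0 : ℝ) < d.1 + d.2 := by linarith
  have hmD : 0 < m * (d.1 + d.2 : ℝ) := by positivity
  have hu : (d.1 : ℝ) - k + k * a + 1 ≤ q * d.1 := by simp only [hq]; nlinarith
  have hv : (d.2 : ℝ) - k + k * a + 1 ≤ q * d.2 := by simp only [hq]; nlinarith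
  have hu0 : 0 < (d.1 : ℝ) - k + k * a + 1 := by linarith
  have hv0 : 0 < (d.2 : ℝ) - k + k * a + 1 := by linarith
  have hs : m * (d.1 + d.2 : ℝ) ≤ d.1 - k + (d.2 - k) + 2 * (k * a) + 1 := by linarith
  have hs' : m * (d.1 + d.2 : ℝ) ≤ d.1 - k + (d.2 - k) + 2 * (k * a) + 2 := by linarith
  have hr0 : 0 ≤ ((d.1 - k + k * a + 1) * (d.2 - k + k * a + 1) : ℝ) /
      ((d.1 - k + (d.2 - k) + 2 * (k * a) + 1) * (d.1 - k + (d.2 - k) + 2 * (k * a) + 2)) :=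
    div_nonneg (by positivity) (mul_nonneg (hmD.le.trans hs) (hmD.le.trans hs'))
  have hr : ((d.1 - k + k * a + 1) * (d.2 - k + k * a + 1) : ℝ) /
      ((d.1 - k + (d.2 - k) + 2 * (k * a) + 1) * (d.1 - k + (d.2 - k) + 2 * (k * a) + 2)) ≤
      q ^ 2 / m ^ 2 * relError d := by
    calc _ ≤ ((q * d.1) * (q * d.2)) / ((m * (d.1 + d.2 : ℝ)) * (m * (d.1 + d.2 : ℝ))) := by
          refine div_le_div₀ (by positivity) ?_ (by positivity) ?_
          · exact mul_le_mul hu hv hv0.le (by positivity)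
          · exact mul_le_mul hs hs' hmD.le (hmD.le.trans hs)
      _ = q ^ 2 / m ^ 2 * ((d.1 * d.2 : ℝ) / ((d.1 : ℝ) + d.2) ^ 2) := by field_simp
      _ ≤ _ := by
          gcongr
          unfold relError
          have : 0 ≤ 1 / (d.1 : ℝ) + 1 / (d.2 : ℝ) := by positivity
          linarith
  rw [add_sub_cancel_left, abs_mul, abs_of_nonneg hr0, mul_assoc]
  exact mul_le_mul (hθ d) hr hr0 hB

end

theorem theorem3 (a : ℝ) (ha : 0 < a) (k : ℕ) (hk : 1 ≤ k) :
    ∃ cX : ℕ → ℕ → ℝ,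
      (∃ C : ℝ, ∀ d₁ d₂ t : ℕ, k ≤ d₁ → k ≤ d₂ → 1 ≤ t →
        |expectedEdges a ha k d₁ d₂ t - cX d₁ d₂ * t| ≤ C) ∧
      (∃ θ : ℕ → ℕ → ℝ, ∀ d₁ d₂ : ℕ, k ≤ d₁ → k ≤ d₂ →
        cX d₁ d₂ =
          (Real.Gamma (d₁ - k + k * a) * Real.Gamma (d₂ - k + k * a) *
              Real.Gamma (d₁ + d₂ - 2 * k + 2 * k * a + 3)) /
            (Real.Gamma (d₁ - k + k * a + 2) * Real.Gamma (d₂ - k + k * a + 2) *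
              Real.Gamma (d₁ + d₂ - 2 * k + 2 * k * a + a + 2)) *
          (k * a * (a + 1) * (Real.Gamma (k * a + a + 1) / Real.Gamma (k * a))) *
          (1 + θ d₁ d₂ *
            (((d₁ - k + k * a + 1) * (d₂ - k + k * a + 1)) /
              ((d₁ + d₂ - 2 * k + 2 * k * a + 1) * (d₁ + d₂ - 2 * k + 2 * k * a + 2)))) ∧
        -4 + 2 / (1 + k * a) ≤ θ d₁ d₂ ∧
        θ d₁ d₂ ≤ a * ((Real.Gamma (k * a + 1) * Real.Gamma (2 * k * a + a + 3)) /
          (Real.Gamma (2 * k * a + 2) * Real.Gamma (k * a + a + 2)))) ∧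
      (∃ C : ℝ, ∀ d₁ d₂ : ℕ, k ≤ d₁ → k ≤ d₂ → ∃ ε : ℝ,
        |ε| ≤ C * (1 / (d₁ : ℝ) + 1 / (d₂ : ℝ) + (d₁ * d₂ : ℝ) / ((d₁ : ℝ) + d₂) ^ 2) ∧
        cX d₁ d₂ =
          k * a * (a + 1) * (Real.Gamma (k * a + a + 1) / Real.Gamma (k * a)) *
            (((d₁ : ℝ) + d₂) ^ (1 - a) / ((d₁ : ℝ) ^ 2 * (d₂ : ℝ) ^ 2)) * (1 + ε)) := by
  have hk0 : (0 : ℝ) < k := by exact_mod_cast hk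
  have hka : 0 < k * a := by positivity
  choose θ hθeq hθlow hθup using exists_linkDensity_eq (a := a) ha hka
  have hcX : ∀ d₁ d₂ : ℕ, k ≤ d₁ → k ≤ d₂ → linkDensity a (k * a) (d₁ - k) (d₂ - k) =
      linkMain a (k * a) (d₁ - k) (d₂ - k) *
        (k * a * (a + 1) * (Real.Gamma (k * a + a + 1) / Real.Gamma (k * a))) *
        (1 + θ (d₁ - k) (d₂ - k) * (((d₁ - k + k * a + 1) * (d₂ - k + k * a + 1)) /
          ((d₁ - k + (d₂ - k) + 2 * (k * a) + 1) *
            (d₁ - k + (d₂ - k) + 2 * (k * a) + 2)))) := by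
    intro d₁ d₂ h₁ h₂
    rw [hθeq, Nat.cast_sub h₁, Nat.cast_sub h₂]
  refine ⟨fun d₁ d₂ => linkDensity a (k * a) (d₁ - k) (d₂ - k), ?_, ?_, ?_⟩
  · obtain ⟨C, hC⟩ := exists_expectedEdges_close ha hk
    refine ⟨C, fun d₁ d₂ t h₁ h₂ _ => ?_⟩
    have h := hC (d₁ - k) (d₂ - k) t
    rwa [Nat.add_sub_cancel' h₁, Nat.add_sub_cancel' h₂] at h
  · refine ⟨fun d₁ d₂ => θ (d₁ - k) (d₂ - k), fun d₁ d₂ h₁ h₂ => ⟨?_, hθlow _ _, ?_⟩⟩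
    · beta_reduce
      rw [hcX d₁ d₂ h₁ h₂, linkMain,
        show (d₁ : ℝ) - k + (d₂ - k) + 2 * (k * a) = d₁ + d₂ - 2 * k + 2 * k * a by ring]
    · have h := hθup (d₁ - k) (d₂ - k)
      rwa [corrUpper, ← mul_assoc] at h
  · set B := max (|-4 + 2 / (1 + k * a)|) |corrUpper a (k * a)| with hB
    have hθB : ∀ d : ℕ × ℕ, |θ (d.1 - k) (d.2 - k)| ≤ B := fun d =>
      abs_le_max_abs_abs (hθlow _ _) (hθup _ _)
    obtain ⟨C, hC⟩ := isBigO_relError_iff.mp (isBigO_mul_sub_one (relError_isBigO_one hk)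
      (isBigO_linkMain ha hk) (isBigO_correction ha hk hθB))
    refine ⟨C, fun d₁ d₂ h₁ h₂ => ⟨_, hC (d₁, d₂) ⟨h₁, h₂⟩, ?_⟩⟩
    have hd₁ : (0 : ℝ) < d₁ := by exact_mod_cast hk.trans h₁
    have hd₂ : (0 : ℝ) < d₂ := by exact_mod_cast hk.trans h₂
    have hpow : 0 < ((d₁ : ℝ) + d₂) ^ (1 - a) := Real.rpow_pos_of_pos (by positivity) _
    simp only [hcX d₁ d₂ h₁ h₂]
    rw [add_sub_cancel]
    generalize (1 + θ (d₁ - k) (d₂ - k) * _ : ℝ) = r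
    field_simp
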